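/- Definitions. A \emph{vertical plane} $(\mathcal{P},\pi)$ is an oriented topological space $\mathcal{P}$ homeomorphic to $\mathbb{R}^2$, together with a locally trivial topological fibration $\pi:\mathcal{P}\to\mathbb{R}$. Let $\mathcal{D}\subset\mathcal{P}$ be a closed subset which, with the induced topology, is a topological surface with non-empty boundary $\mathcal{C}$. It is a \emph{domain of finite type} if the restriction $\pi|_{\mathcal{D}}:\mathcal{D}\to\mathbb{R}$ is proper and if only finitely many points $p\in\mathcal{C}$ are topologically critical, that is, have no open neighbourhood in $\mathcal{C}$ which $\pi$ maps homeomorphically onto its image. Two points $P,Q\in\mathcal{P}$ are \emph{vertically equivalent relative to $\mathcal{D}$}, $P\sim_{\mathcal{D}}Q$, if $\pi(P)=\pi(Q)=:x_0$ and either $P,Q$ lie in the same connected component of $\pi^{-1}(x_0)\cap\mathcal{D}$, or $P=Q\notin\mathcal{D}$. The \emph{$\mathcal{D}$-collapse} is the topological quotient $\tilde{\mathcal{P}}:=\mathcal{P}/{\sim_{\mathcal{D}}}$, and $\rho_{\mathcal{D}}:\mathcal{P}\to\tilde{\mathcal{P}}$ is the quotient map. Proposition. Let $\mathcal{D}$ be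 a domain of finite type in a vertical plane $(\mathcal{P},\pi)$. Then: (1) $\tilde{\mathcal{P}}$ is homeomorphic to $\mathbb{R}^2$; (2) $\pi$ descends to $\tilde{\mathcal{P}}$: there is a unique function $\tilde\pi:\tilde{\mathcal{P}}\to\mathbb{R}$ with $\tilde\pi\circ\rho_{\mathcal{D}}=\pi$; (3) $\rho_{\mathcal{D}}$ restricts to a homeomorphism from $\mathcal{P}\setminus\mathcal{D}$ onto its image, which is open in $\tilde{\mathcal{P}}$; (4) there is a unique orientation of $\tilde{\mathcal{P}}$ for which the homeomorphism in (3) preserves orientations at every point of $\mathcal{P}\setminus\mathcal{D}$, and, endowed with this orientation, $(\tilde{\mathcal{P}},\tilde\pi)$ is again a vertical plane (with $\tilde\pi\circ\rho_{\mathcal{D}}=\pi$). -/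

import Mathlib

open Set Filter Topology

/-! ### Orientations of topological planes -/

/-- `f` preserves the orientation of `ℝ²` at `p`: for all sufficiently small `r > 0`, the image under
`f` of the counterclockwise circle of center `p` and radius `r` is a loop which avoids `f p` and has
winding number `+1` around `f p`, that is, `f (p + r (cos t, sin t)) - f p` has a continuous argument
`θ t` which increases by `2π` when `t` does. (Used for maps that are local homeomorphisms at `p`.) -/
def PreservesOrientationAt (f : ℝ × ℝ → ℝ × ℝ) (p : ℝ × ℝ) : Prop :=
  ∀ᶠ r : ℝ in 𝓝[>] 0, ∃ θ : ℝ → ℝ, Continuous θ ∧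
    (∀ t, θ (t + 2 * Real.pi) = θ t + 2 * Real.pi) ∧
    ∀ t, ∃ s : ℝ, 0 < s ∧
      f (p + r • (Real.cos t, Real.sin t)) = f p + s • (Real.cos (θ t), Real.sin (θ t))

/-- An orientation of a space `X` homeomorphic to `ℝ²`: a class of global charts `X ≃ₜ ℝ²` (the
positive ones) modulo orientation-preserving homeomorphisms of `ℝ²`. -/
@[ext]
structure PlaneOrientation (X : Type*) [TopologicalSpace X] where
  charts : Set (X ≃ₜ ℝ × ℝ)
  nonempty : charts.Nonempty
  mem_iff : ∀ e ∈ charts, ∀ e' : X ≃ₜ ℝ × ℝ,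
    e' ∈ charts ↔ ∀ p : ℝ × ℝ, PreservesOrientationAt (fun q => e' (e.symm q)) p

/-- A map `F` between oriented planes preserves the orientations at `x`, as seen in positive
charts. -/
def PlaneOrientation.PreservedAt {X Y : Type*} [TopologicalSpace X] [TopologicalSpace Y]
    (oX : PlaneOrientation X) (oY : PlaneOrientation Y) (F : X → Y) (x : X) : Prop :=
  ∀ e ∈ oX.charts, ∀ e' ∈ oY.charts, PreservesOrientationAt (fun q => e' (F (e.symm q))) (e x)

/-! ### Vertical planes -/

/-- `π` is a locally trivial topological fibration over `ℝ`: near every `x`, it is isomorphic to the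
projection of a product with the fiber over `x`. -/
def IsLocallyTrivialFibration {X : Type*} [TopologicalSpace X] (π : X → ℝ) : Prop :=
  ∀ x : ℝ, ∃ e : Bundle.Trivialization (π ⁻¹' {x}) π, x ∈ e.baseSet

/-- The structure of a vertical plane on a topological space `P`. -/
@[ext]
structure VerticalPlane (P : Type*) [TopologicalSpace P] where
  homeomorphic_plane : Nonempty (P ≃ₜ ℝ × ℝ)
  orientation : PlaneOrientation P
  proj : P → ℝ
  locallyTrivial : IsLocallyTrivialFibration proj

/-! ### Domains of finite type -/

/-- The subset `D`, with its induced topology, is a topological surface, possibly with boundary: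
every point has an open neighborhood in `D` homeomorphic to an open subset of a closed half-plane.
(The Hausdorff property and second countability are inherited from the ambient plane.) -/
def IsSurfaceWithBoundary {P : Type*} [TopologicalSpace P] (D : Set P) : Prop :=
  ∀ p : D, ∃ e : OpenPartialHomeomorph D (EuclideanHalfSpace 2), p ∈ e.source

/-- The boundary (in the sense of manifolds) of the surface `D`: the points which some chart sends
to the boundary line of the half-plane. -/
def surfaceBoundary {P : Type*} [TopologicalSpace P] (D : Set P) : Set P :=
  {p | ∃ hp : p ∈ D, ∃ e : OpenPartialHomeomorph D (EuclideanHalfSpace 2),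
    (⟨p, hp⟩ : D) ∈ e.source ∧ (e ⟨p, hp⟩).1 0 = 0}

/-- The topological critical set of the restriction of `π` to the curve `C`: the points of `C`
without an open neighborhood in `C` that `π` maps homeomorphically onto its image. -/
def topCriticalSet {P : Type*} [TopologicalSpace P] (π : P → ℝ) (C : Set P) : Set P :=
  {p | p ∈ C ∧ ¬ ∃ U : Set P, IsOpen U ∧ p ∈ U ∧ IsEmbedding ((U ∩ C).domRestrict π)}

/-- Domains of finite type in a vertical plane. -/
structure VerticalPlane.IsDomainOfFiniteType {P : Type*} [TopologicalSpace P]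
    (V : VerticalPlane P) (D : Set P) : Prop where
  isClosed : IsClosed D
  surface : IsSurfaceWithBoundary D
  boundary_nonempty : (surfaceBoundary D).Nonempty
  proper : IsProperMap (D.domRestrict V.proj)
  finite_critical : (topCriticalSet V.proj (surfaceBoundary D)).Finite

/-! ### The collapse -/

/-- `P` and `Q` are vertically equivalent relative to `D`: they lie on the same fiber of `π`, and
either they are in the same connected component of the intersection of this fiber with `D`, or they
are equal and outside `D`. -/
def VerticallyEquivalent {P : Type*} [TopologicalSpace P] (π : P → ℝ) (D : Set P) (p q : P) : Prop :=
  π p = π q ∧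
    ((p ∈ D ∧ q ∈ connectedComponentIn (π ⁻¹' {π p} ∩ D) p) ∨ (p = q ∧ p ∉ D))

theorem verticallyEquivalent_equivalence {P : Type*} [TopologicalSpace P] (π : P → ℝ) (D : Set P) :
    Equivalence (VerticallyEquivalent π D) where
  refl p := by
    refine ⟨rfl, ?_⟩
    by_cases hp : p ∈ D
    · exact Or.inl ⟨hp, mem_connectedComponentIn ⟨rfl, hp⟩⟩
    · exact Or.inr ⟨rfl, hp⟩
  symm := by
    rintro p q ⟨h, ⟨hp, hq⟩ | ⟨rfl, hp⟩⟩
    · have hqD := connectedComponentIn_subset _ _ hq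
      refine ⟨h.symm, Or.inl ⟨hqD.2, ?_⟩⟩
      rw [← h, ← connectedComponentIn_eq hq]
      exact mem_connectedComponentIn ⟨rfl, hp⟩
    · exact ⟨rfl, Or.inr ⟨rfl, hp⟩⟩
  trans := by
    rintro p q r ⟨h, ⟨hp, hq⟩ | ⟨rfl, hp⟩⟩ ⟨h', h2⟩
    · have hqD := connectedComponentIn_subset _ _ hq
      rcases h2 with ⟨_, hr⟩ | ⟨rfl, hq'⟩
      · refine ⟨h.trans h', Or.inl ⟨hp, ?_⟩⟩
        rw [← h, ← connectedComponentIn_eq hq] at hr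
        exact hr
      · exact absurd hqD.2 hq'
    · exact ⟨h', h2⟩

/-- Vertical equivalence relative to `D`, as a setoid. -/
def verticalSetoid {P : Type*} [TopologicalSpace P] (π : P → ℝ) (D : Set P) : Setoid P :=
  ⟨VerticallyEquivalent π D, verticallyEquivalent_equivalence π D⟩

/-- The `D`-collapse of the vertical plane, with the quotient topology. -/
abbrev VerticalPlane.Collapse {P : Type*} [TopologicalSpace P] (V : VerticalPlane P) (D : Set P) :
    Type _ :=
  Quotient (verticalSetoid V.proj D)

/-- The collapsing map relative to `D`. -/
def VerticalPlane.collapseMap {P : Type*} [TopologicalSpace P] (V : VerticalPlane P) (D : Set P) :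
    P → V.Collapse D :=
  Quotient.mk (verticalSetoid V.proj D)

/-!
The projection of a vertical plane is, up to a homeomorphism, the first projection of `ℝ × ℝ`
(`IsLocallyTrivialFibration.exists_homeomorph`). In such coordinates, with `D` becoming `E`, the
collapse can be written down: it is `(x, y) ↦ (x, f (x, y))`, where `f (x, y)` is the signed length
of the part outside `E` of the vertical segment from `(x, 0)` to `(x, y)` (`heightOutside`,
`collapseCoord`). Two points of a vertical line have the same image if and only if the segment
between them lies in `E`, that is, if and only if they are vertically equivalent
(`verticallyEquivalent_iff`). The function `f` is continuous by dominated convergence, because the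
frontier of `D` meets every fiber in a countable set: by invariance of domain it consists of
boundary points of the surface `D`, and the noncritical boundary points are isolated in their fiber.
Properness of `π` on `D` makes the map proper and surjective, hence a quotient map, and the collapse
is identified with `ℝ × ℝ`, with the first coordinate as projection.

That the fibration is trivial with fiber the line has two parts. A locally trivial fibration over
`ℝ` is trivial (`exists_homeomorph_prod_of_forall_trivialization`), and a space `F` such that
`F × ℝ` is a plane is a line (`nonempty_homeomorph_real_of_prod`). For the second one, the
logarithms of `h (a, s) - h (p, 0)` on the two planes slit along one half of the line `{p} × ℝ`
differ by a locally constant function of `p ≠ a`. A Mayer-Vietoris argument shows that it takes two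
values, so that each point `p` separates `F` into two sides. This defines a linear order on `F`, and
a separable connected linear order is identified with `ℝ` through a countable dense subset.

The algebraic topology of the plane is reduced to continuous logarithms: homotopy lifting for the
exponential gives a logarithm of any nonvanishing continuous function on a contractible space. In
particular, the local degree of a map `f` at `p` is the increment of a logarithm of
`f (p + exp z) - f p` along the period `2πi` (`DegreeAt`). It is multiplicative, constant and equal
to `±1` for homeomorphisms of the plane, and odd for injective maps, from which invariance of domain
follows. A map with a local degree preserves the orientation at `p` if and only if the degree is
`1`. In vertical coordinates the collapse has degree `1` at all points outside `E`, since it is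
increasing on vertical lines. So one sign relates the positive charts of the plane to those of its
collapse at all the points outside `D`, in whichever component they are, and it determines the
orientation of the collapse.
-/

/-! ### Continuous logarithms -/

/-- Homotopy lifting for the exponential: a logarithm of one end of a homotopy of nonvanishing
functions extends to a logarithm of the whole homotopy. -/
theorem exists_log_of_homotopy {A : Type*} [TopologicalSpace A] {H : unitInterval × A → ℂ}
    (hH : Continuous H) (h0 : ∀ x, H x ≠ 0) {g : A → ℂ} (hg : Continuous g)
    (hHg : ∀ a, H (0, a) = Complex.exp (g a)) :
    ∃ G : unitInterval × A → ℂ, Continuous G ∧ ∀ x, H x = Complex.exp (G x) := by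
  let H' : C(unitInterval × A, {z : ℂ // z ≠ 0}) := ⟨fun x => ⟨H x, h0 x⟩, by fun_prop⟩
  have key := Complex.isCoveringMap_exp.liftHomotopy_lifts H' ⟨g, hg⟩
    (fun a => Subtype.ext (hHg a))
  exact ⟨_, ContinuousMap.continuous _, fun x => (congrArg Subtype.val (congrFun key x)).symm⟩

theorem exists_log_of_contractible {A : Type*} [TopologicalSpace A] [ContractibleSpace A]
    {f : A → ℂ} (hf : Continuous f) (h0 : ∀ a, f a ≠ 0) :
    ∃ g : A → ℂ, Continuous g ∧ ∀ a, f a = Complex.exp (g a) := by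
  obtain ⟨y, ⟨K⟩⟩ := id_nullhomotopic A
  obtain ⟨G, hG, hGH⟩ := exists_log_of_homotopy (H := fun x => f (K.symm x)) (by fun_prop)
    (fun x => h0 _) (g := fun _ => Complex.log (f y)) continuous_const
    (fun a => by simp [Complex.exp_log (h0 y)])
  refine ⟨fun a => G (1, a), by fun_prop, fun a => ?_⟩
  rw [← hGH]
  simp

/-- Two continuous logarithms of the same function differ by a continuous integral multiple of
`2πi`. -/
theorem exists_int_of_exp_eq {X : Type*} [TopologicalSpace X] {g₁ g₂ : X → ℂ} (h₁ : Continuous g₁)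
    (h₂ : Continuous g₂) (h : ∀ x, Complex.exp (g₁ x) = Complex.exp (g₂ x)) :
    ∃ k : X → ℤ, Continuous k ∧ ∀ x, g₁ x = g₂ x + k x * (2 * Real.pi * Complex.I) := by
  choose k hk using fun x => Complex.exp_eq_exp_iff_exists_int.1 (h x)
  refine ⟨k, ?_, hk⟩
  rw [Int.isClosedEmbedding_coe_real.isInducing.continuous_iff]
  have : ((↑) : ℤ → ℝ) ∘ k = fun x => ((g₁ x - g₂ x) / (2 * Real.pi * Complex.I)).re := by
    ext x
    have := Complex.two_pi_I_ne_zero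
    simp only [Function.comp_apply]
    rw [hk x, add_sub_cancel_left, mul_div_cancel_right₀ _ this]
    simp
  rw [this]
  fun_prop

theorem exists_int_const_of_exp_eq {X : Type*} [TopologicalSpace X] [PreconnectedSpace X]
    {g₁ g₂ : X → ℂ} (h₁ : Continuous g₁) (h₂ : Continuous g₂)
    (h : ∀ x, Complex.exp (g₁ x) = Complex.exp (g₂ x)) :
    ∃ k : ℤ, ∀ x, g₁ x = g₂ x + k * (2 * Real.pi * Complex.I) := by
  obtain ⟨k, hk, hk'⟩ := exists_int_of_exp_eq h₁ h₂ h
  rcases isEmpty_or_nonempty X with hX | ⟨⟨x₀⟩⟩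
  · exact ⟨0, fun x => hX.elim x⟩
  · exact ⟨k x₀, fun x => by rw [hk' x, PreconnectedSpace.constant ‹_› hk (x := x) (y := x₀)]⟩

/-! ### The local degree of a map of the plane -/

/-- `f` has local degree `n` at `p`, for a map of the plane which takes the value `f p` only at `p`:
in the logarithmic coordinate `z`, with `q = p + exp z`, the map `f - f p` has a continuous
logarithm which increases by `2πi n` when `z` increases by `2πi`. -/
def DegreeAt (f : ℂ → ℂ) (p : ℂ) (n : ℤ) : Prop :=
  ∃ g : ℂ → ℂ, Continuous g ∧ (∀ z, f (p + Complex.exp z) = f p + Complex.exp (g z)) ∧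
    ∀ z, g (z + 2 * Real.pi * Complex.I) = g z + n * (2 * Real.pi * Complex.I)

theorem exp_add_two_pi_I (z : ℂ) : Complex.exp (z + 2 * Real.pi * Complex.I) = Complex.exp z :=
  Complex.exp_periodic z

/-- A nonvanishing continuous function of `exp z` and of a parameter has a logarithm, and its
increment along the period of `exp` does not depend on the parameter. -/
theorem exists_log_comp_exp {A : Type*} [TopologicalSpace A] [ContractibleSpace A]
    {f : A × ℂ → ℂ} (hf : Continuous f) (h0 : ∀ x, f x ≠ 0)
    (hper : ∀ a z, f (a, z + 2 * Real.pi * Complex.I) = f (a, z)) :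
    ∃ g : A × ℂ → ℂ, Continuous g ∧ (∀ x, f x = Complex.exp (g x)) ∧
      ∃ n : ℤ, ∀ a z,
        g (a, z + 2 * Real.pi * Complex.I) = g (a, z) + n * (2 * Real.pi * Complex.I) := by
  obtain ⟨g, hg, hfg⟩ := exists_log_of_contractible hf h0
  obtain ⟨n, hn⟩ := exists_int_const_of_exp_eq
    (g₁ := fun x : A × ℂ => g (x.1, x.2 + 2 * Real.pi * Complex.I)) (g₂ := g)
    (by fun_prop) hg (fun x => by rw [← hfg, ← hfg, hper])
  exact ⟨g, hg, hfg, n, fun a z => hn (a, z)⟩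

/-- The local degree of an injective map of the plane does not depend on the point: a single
logarithm of `f (p + exp z) - f p`, in the variables `p` and `z`, computes all of them. -/
theorem exists_degreeAt_of_injective {f : ℂ → ℂ} (hf : Continuous f) (hi : Function.Injective f) :
    ∃ n, ∀ p, DegreeAt f p n := by
  obtain ⟨g, hg, hfg, n, hn⟩ := exists_log_comp_exp
    (f := fun x : ℂ × ℂ => f (x.1 + Complex.exp x.2) - f x.1) (by fun_prop)
    (fun x => by simp [sub_eq_zero, hi.eq_iff]) (fun a z => by simp only [exp_add_two_pi_I])
  exact ⟨n, fun p => ⟨fun z => g (p, z), by fun_prop, fun z => by rw [← hfg]; ring,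
    fun z => hn p z⟩⟩

theorem DegreeAt.comp {f f' : ℂ → ℂ} {p : ℂ} {n m : ℤ} (h' : DegreeAt f' (f p) m)
    (h : DegreeAt f p n) : DegreeAt (f' ∘ f) p (m * n) := by
  obtain ⟨g, hg, hfg, hgn⟩ := h
  obtain ⟨g', hg', hfg', hgm⟩ := h'
  -- the composite of the two logarithms works: `g'` increases by `k m` periods along `k` periods
  have key : ∀ (k : ℤ) z, g' (z + k * (2 * Real.pi * Complex.I)) =
      g' z + m * k * (2 * Real.pi * Complex.I) := by
    intro k
    induction k using Int.induction_on with
    | zero => simp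
    | succ i hi =>
      intro z
      have := hgm (z + i * (2 * Real.pi * Complex.I))
      rw [show z + ((i : ℤ) + 1 : ℤ) * (2 * Real.pi * Complex.I) =
        z + i * (2 * Real.pi * Complex.I) + 2 * Real.pi * Complex.I by push_cast; ring, this]
      have := hi z
      push_cast at this ⊢
      rw [this]; ring
    | pred i hi =>
      intro z
      have := hgm (z + (-i - 1 : ℤ) * (2 * Real.pi * Complex.I))
      rw [show z + (-i - 1 : ℤ) * (2 * Real.pi * Complex.I) + 2 * Real.pi * Complex.I =
        z + (-i : ℤ) * (2 * Real.pi * Complex.I) by push_cast; ring, hi z] at this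
      push_cast at this ⊢
      linear_combination -this
  refine ⟨g' ∘ g, hg'.comp hg, fun z => by simp [hfg, hfg'], fun z => ?_⟩
  simp only [Function.comp_apply, hgn, key]
  push_cast; ring

theorem degreeAt_id (p : ℂ) : DegreeAt id p 1 :=
  ⟨id, continuous_id, fun z => rfl, fun z => by simp⟩

/-- The increment along a period, which is a winding number, depends only on the function of which
a logarithm is taken. -/
theorem log_increment_unique {g g' : ℂ → ℂ} (hg : Continuous g) (hg' : Continuous g')
    (h : ∀ z, Complex.exp (g z) = Complex.exp (g' z)) {n m : ℤ}
    (hn : ∀ z, g (z + 2 * Real.pi * Complex.I) = g z + n * (2 * Real.pi * Complex.I))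
    (hm : ∀ z, g' (z + 2 * Real.pi * Complex.I) = g' z + m * (2 * Real.pi * Complex.I)) :
    n = m := by
  obtain ⟨k, hk⟩ := exists_int_const_of_exp_eq hg hg' h
  have h1 := hk (0 + 2 * Real.pi * Complex.I)
  rw [hn, hm, hk] at h1
  have h2 : ((n : ℂ) - m) * (2 * Real.pi * Complex.I) = 0 := by linear_combination h1
  have := (mul_eq_zero.1 h2).resolve_right Complex.two_pi_I_ne_zero
  exact_mod_cast sub_eq_zero.1 this

theorem DegreeAt.unique {f : ℂ → ℂ} {p : ℂ} {n m : ℤ} (h : DegreeAt f p n) (h' : DegreeAt f p m) :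
    n = m := by
  obtain ⟨g, hg, hfg, hgn⟩ := h
  obtain ⟨g', hg', hfg', hgm⟩ := h'
  exact log_increment_unique hg hg' (fun z => add_left_cancel ((hfg z).symm.trans (hfg' z)))
    hgn hgm

/-- The local degree of a homeomorphism of the plane is `1` everywhere or `-1` everywhere. -/
theorem Homeomorph.exists_degreeAt (h : ℂ ≃ₜ ℂ) :
    ∃ n : ℤ, (n = 1 ∨ n = -1) ∧ ∀ p, DegreeAt h p n := by
  obtain ⟨n, hn⟩ := exists_degreeAt_of_injective h.continuous h.injective
  obtain ⟨m, hm⟩ := exists_degreeAt_of_injective h.symm.continuous h.symm.injective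
  have h1 := (hm _).comp (hn 0)
  rw [h.symm_comp_self] at h1
  have h2 := h1.unique (degreeAt_id 0)
  rcases Int.mul_eq_one_iff_eq_one_or_neg_one.1 h2 with ⟨rfl, rfl⟩ | ⟨rfl, rfl⟩
  · exact ⟨1, .inl rfl, hn⟩
  · exact ⟨-1, .inr rfl, hn⟩

theorem degreeAt_conj (p : ℂ) : DegreeAt (starRingEnd ℂ) p (-1) := by
  refine ⟨starRingEnd ℂ, Complex.continuous_conj, fun z => by simp [Complex.exp_conj], fun z => ?_⟩
  simp [map_ofNat]

theorem contractibleSpace_unitInterval : ContractibleSpace unitInterval :=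
  (convex_Icc (0 : ℝ) 1).contractibleSpace ⟨0, by simp⟩

/-- Local degrees are invariant under homotopies through maps which take the value at `p` only
at `p`. -/
theorem DegreeAt.of_homotopy {H : unitInterval × ℂ → ℂ} (hH : Continuous H) {p : ℂ}
    (h0 : ∀ s q, q ≠ p → H (s, q) ≠ H (s, p)) {n : ℤ} (h : DegreeAt (fun q => H (0, q)) p n) :
    DegreeAt (fun q => H (1, q)) p n := by
  have := contractibleSpace_unitInterval
  obtain ⟨g, hg, hfg, m, hm⟩ := exists_log_comp_exp
    (f := fun x : unitInterval × ℂ => H (x.1, p + Complex.exp x.2) - H (x.1, p)) (by fun_prop)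
    (fun x => sub_ne_zero.2 (h0 _ _ (by simp))) (fun a z => by simp only [exp_add_two_pi_I])
  have key : ∀ s, DegreeAt (fun q => H (s, q)) p m := fun s =>
    ⟨fun z => g (s, z), by fun_prop, fun z => by rw [← hfg]; ring, fun z => hm s z⟩
  rw [h.unique (key 0)]
  exact key 1

/-! ### Invariance of domain in the plane -/

/-- The local degree of an injective map is odd: `φ (e) - φ (0)` is homotopic, as a function of
`e ≠ 0`, to the odd function `φ (e / 2) - φ (-e / 2)`. -/
theorem odd_degreeAt_of_injective {φ : ℂ → ℂ} (hφ : Continuous φ) (hi : Function.Injective φ) :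
    ∃ n, Odd n ∧ DegreeAt φ 0 n := by
  have := contractibleSpace_unitInterval
  have ht : ∀ t : unitInterval, (1 + (t : ℝ) : ℂ) ≠ 0 := fun t => by
    exact_mod_cast (by linarith [t.2.1] : (0 : ℝ) < 1 + t).ne'
  obtain ⟨g, hg, hfg, n, hn⟩ := exists_log_comp_exp
    (f := fun x : unitInterval × ℂ => φ (Complex.exp x.2 / (1 + (x.1 : ℝ))) -
      φ (-(x.1 : ℝ) * Complex.exp x.2 / (1 + (x.1 : ℝ))))
    (by
      have h1 : Continuous fun x : unitInterval × ℂ => Complex.exp x.2 / (1 + ((x.1 : ℝ) : ℂ)) :=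
        (by fun_prop : Continuous fun x : unitInterval × ℂ => Complex.exp x.2).div
          (by fun_prop) (fun x => ht _)
      have h2 : Continuous fun x : unitInterval × ℂ =>
          -((x.1 : ℝ) : ℂ) * Complex.exp x.2 / (1 + ((x.1 : ℝ) : ℂ)) :=
        (by fun_prop : Continuous fun x : unitInterval × ℂ =>
          -((x.1 : ℝ) : ℂ) * Complex.exp x.2).div (by fun_prop) (fun x => ht _)
      exact (hφ.comp h1).sub (hφ.comp h2))
    (fun x => by
      rw [sub_ne_zero, hi.ne_iff]
      intro h
      rw [div_left_inj' (ht _)] at h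
      have : (1 + (x.1 : ℝ) : ℂ) * Complex.exp x.2 = 0 := by linear_combination h
      exact (mul_ne_zero (ht _) (Complex.exp_ne_zero _)) this)
    (fun a z => by simp only [exp_add_two_pi_I])
  refine ⟨n, ?_, fun z => g (0, z), by fun_prop, fun z => ?_, fun z => hn 0 z⟩
  -- at `t = 1` the function changes sign along half a period, so that its logarithm increases by an
  -- odd multiple of `πi` along each of the two halves, always the same one
  · obtain ⟨k, hk⟩ := exists_int_const_of_exp_eq (g₁ := fun z => g (1, z + Real.pi * Complex.I))
      (g₂ := fun z => g (1, z) + Real.pi * Complex.I) (by fun_prop) (by fun_prop) (fun z => by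
        rw [← hfg, Complex.exp_add (g _), ← hfg]
        simp [Complex.exp_add, Complex.exp_pi_mul_I])
    refine ⟨k, ?_⟩
    have h1 := hn 1 0
    have h2 := hk 0
    have h3 := hk (0 + Real.pi * Complex.I)
    simp only [show (0 : ℂ) + Real.pi * Complex.I + Real.pi * Complex.I =
      0 + 2 * Real.pi * Complex.I by ring] at h3
    have h4 : ((n : ℂ) - (2 * k + 1)) * (2 * Real.pi * Complex.I) = 0 := by
      linear_combination h3 + h2 - h1
    have := (mul_eq_zero.1 h4).resolve_right Complex.two_pi_I_ne_zero
    exact_mod_cast sub_eq_zero.1 this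
  · rw [← hfg]
    simp

/-- A continuous injective map of the plane covers a neighborhood of each of its values: around a
nearby omitted value, its winding number along the unit circle would be both odd and zero. -/
theorem range_mem_nhds_of_injective {φ : ℂ → ℂ} (hφ : Continuous φ) (hi : Function.Injective φ) :
    range φ ∈ 𝓝 (φ 0) := by
  have := contractibleSpace_unitInterval
  obtain ⟨n, hodd, g, hg, hfg, hgn⟩ := odd_degreeAt_of_injective hφ hi
  obtain ⟨u, hu, hmin⟩ := (isCompact_sphere (0 : ℂ) 1).exists_isMinOn ⟨1, by simp⟩
    (f := fun u => ‖φ u - φ 0‖) (by fun_prop)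
  have hδ : 0 < ‖φ u - φ 0‖ := by
    rw [norm_pos_iff, sub_ne_zero, hi.ne_iff]
    rintro rfl
    simp at hu
  refine Metric.mem_nhds_iff.2 ⟨_, hδ, fun q hq => ?_⟩
  by_contra hqr
  have hqφ : ∀ w, φ w ≠ q := fun w hw => hqr ⟨w, hw⟩
  -- the point of the unit circle with the argument of `exp z`
  let c : ℂ → ℂ := fun z => (z.im : ℂ) * Complex.I
  have hc : Continuous c := by fun_prop
  have hcper : ∀ z, c (z + 2 * Real.pi * Complex.I) = c z + 2 * Real.pi * Complex.I := by
    intro z; simp [c]; ring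
  have hcn : ∀ z, ‖Complex.exp (c z)‖ = 1 := fun z => Complex.norm_exp_ofReal_mul_I _
  -- the winding number of the image of the unit circle is the same around `φ 0` and around `q`
  obtain ⟨g₁, hg₁, hfg₁, n₁, hn₁⟩ := exists_log_comp_exp
    (f := fun x : unitInterval × ℂ => φ (Complex.exp (c x.2)) - (φ 0 + (x.1 : ℝ) * (q - φ 0)))
    (by fun_prop) (fun x => by
      have h1 : ‖φ u - φ 0‖ ≤ ‖φ (Complex.exp (c x.2)) - φ 0‖ := hmin (by simp [hcn])
      have h2 : ‖((x.1 : ℝ) : ℂ) * (q - φ 0)‖ ≤ ‖q - φ 0‖ := by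
        rw [norm_mul, Complex.norm_real, Real.norm_of_nonneg x.1.2.1]
        exact mul_le_of_le_one_left (norm_nonneg _) x.1.2.2
      have h3 : ‖q - φ 0‖ < ‖φ u - φ 0‖ := by simpa [dist_eq_norm] using hq
      intro h
      rw [show φ (Complex.exp (c x.2)) - φ 0 = ((x.1 : ℝ) : ℂ) * (q - φ 0) by
        linear_combination h] at h1
      linarith)
    (fun a z => by simp only [hcper, exp_add_two_pi_I])
  -- around the omitted value `q`, the image of the circle can be contracted
  obtain ⟨g₂, hg₂, hfg₂, n₂, hn₂⟩ := exists_log_comp_exp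
    (f := fun x : unitInterval × ℂ => φ ((x.1 : ℝ) * Complex.exp (c x.2)) - q)
    (by fun_prop) (fun x => sub_ne_zero.2 (hqφ _))
    (fun a z => by simp only [hcper, exp_add_two_pi_I])
  have e1 : n = n₁ := log_increment_unique (g := fun z => g (c z)) (g' := fun z => g₁ (0, z))
    (by fun_prop) (by fun_prop) (fun z => by
      rw [← hfg₁]
      have := hfg (c z)
      rw [zero_add] at this
      simp [this]) (fun z => by rw [hcper, hgn]) (hn₁ 0)
  have e2 : n₁ = n₂ := log_increment_unique (g := fun z => g₁ (1, z)) (g' := fun z => g₂ (1, z))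
    (by fun_prop) (by fun_prop) (fun z => by rw [← hfg₁, ← hfg₂]; simp) (hn₁ 1) (hn₂ 1)
  have e3 : n₂ = 0 := log_increment_unique (g := fun z => g₂ (0, z))
    (g' := fun z => Complex.log (φ 0 - q)) (by fun_prop) (by fun_prop) (fun z => by
      rw [← hfg₂, Complex.exp_log (sub_ne_zero.2 (hqφ 0))]; simp) (hn₂ 0) (by simp)
  rw [e1, e2, e3] at hodd
  simp at hodd

/-- A point of a surface in the plane which is not on its boundary is interior in the plane. -/
theorem mem_interior_of_notMem_surfaceBoundary {P : Type*} [TopologicalSpace P] (k : P ≃ₜ ℂ)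
    {D : Set P} (hD : IsSurfaceWithBoundary D) {p : P} (hp : p ∈ D)
    (hpC : p ∉ surfaceBoundary D) : p ∈ interior D := by
  obtain ⟨e, he⟩ := hD ⟨p, hp⟩
  set v : EuclideanSpace ℝ (Fin 2) := (e ⟨p, hp⟩).1 with hv
  have hv0 : 0 < v 0 := lt_of_le_of_ne (e ⟨p, hp⟩).2 (fun h => hpC ⟨hp, e, he, h.symm⟩)
  obtain ⟨O, hO, hOe⟩ := isOpen_induced_iff.1 e.open_target
  have hvO : v ∈ O := by
    have : e ⟨p, hp⟩ ∈ Subtype.val ⁻¹' O := hOe ▸ e.map_source he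
    exact this
  have hW : O ∩ {w : EuclideanSpace ℝ (Fin 2) | 0 < w 0} ∈ 𝓝 v :=
    inter_mem (hO.mem_nhds hvO)
      ((isOpen_lt continuous_const (by fun_prop)).mem_nhds hv0)
  obtain ⟨ε, hε, hball⟩ := Metric.mem_nhds_iff.1 hW
  -- `ψ` parametrizes by the whole plane a small disc around `v` off the boundary line
  let b := OpenPartialHomeomorph.univBall v ε
  let r := Complex.orthonormalBasisOneI.repr
  have hbt : ∀ w, b w ∈ Metric.ball v ε := fun w => by
    have := b.map_source (x := w) (by simp [b])
    rwa [OpenPartialHomeomorph.univBall_target v hε] at this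
  let ψ : ℂ → EuclideanHalfSpace 2 := fun z => ⟨b (r z), (hball (hbt _)).2.le⟩
  have hψ : Continuous ψ := Continuous.subtype_mk
    ((OpenPartialHomeomorph.continuous_univBall v ε).comp r.continuous) _
  have hψi : Function.Injective ψ := fun z z' h => by
    have h' : b (r z) = b (r z') := congrArg Subtype.val h
    exact r.injective (b.injOn (by simp [b]) (by simp [b]) h')
  have hψt : ∀ z, ψ z ∈ e.target := fun z => by
    rw [← hOe]; exact (hball (hbt _)).1
  have hψ0 : e.symm (ψ 0) = ⟨p, hp⟩ := by
    have : ψ 0 = e ⟨p, hp⟩ := Subtype.ext (by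
      simp only [ψ, map_zero]
      exact OpenPartialHomeomorph.univBall_apply_zero v ε)
    rw [this, e.left_inv he]
  have key := range_mem_nhds_of_injective (φ := fun z => k (e.symm (ψ z)))
    (k.continuous.comp (continuous_subtype_val.comp
      (e.continuousOn_symm.comp_continuous hψ hψt)))
    (fun z z' h => hψi (e.symm.injOn (hψt z) (hψt z') (Subtype.ext (k.injective h))))
  simp only [hψ0] at key
  rw [mem_interior_iff_mem_nhds]
  have h2 := k.continuous.continuousAt.preimage_mem_nhds key
  refine mem_of_superset h2 ?_
  rintro q ⟨z, hz⟩
  rw [← k.injective hz]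
  exact (e.symm (ψ z)).2

/-! ### Locally trivial fibrations over the line -/

/-- A locally trivial fibration over the line is trivial over compact intervals (see
`FiberBundle.exists_trivialization_Icc_subset` for the same argument). -/
theorem exists_trivialization_Icc_subset {X F : Type*} [TopologicalSpace X] [TopologicalSpace F]
    {π : X → ℝ} (h : ∀ x, ∃ e : Bundle.Trivialization F π, x ∈ e.baseSet) (a b : ℝ) :
    ∃ e : Bundle.Trivialization F π, Icc a b ⊆ e.baseSet := by
  obtain ⟨ea, hea⟩ := h a
  rcases lt_or_ge b a with _ | hab
  · exact ⟨ea, by simp [*]⟩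
  set s : Set ℝ := {x ∈ Icc a b | ∃ e : Bundle.Trivialization F π, Icc a x ⊆ e.baseSet}
  have ha : a ∈ s := ⟨left_mem_Icc.2 hab, ea, by simp [hea]⟩
  have hsb : b ∈ upperBounds s := fun x hx => hx.1.2
  set c := sSup s
  have hsc : IsLUB s c := isLUB_csSup ⟨a, ha⟩ ⟨b, hsb⟩
  have hc : c ∈ Icc a b := ⟨hsc.1 ha, hsc.2 hsb⟩
  obtain ⟨-, ec, hec⟩ : c ∈ s := by
    rcases hc.1.eq_or_lt with heq | hlt
    · rwa [← heq]
    refine ⟨hc, ?_⟩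
    obtain ⟨ec, hc⟩ := h c
    obtain ⟨c', hc', hc'e⟩ : ∃ c' ∈ Ico a c, Ioc c' c ⊆ ec.baseSet :=
      (mem_nhdsLE_iff_exists_mem_Ico_Ioc_subset hlt).1
        (mem_nhdsWithin_of_mem_nhds <| IsOpen.mem_nhds ec.open_baseSet hc)
    obtain ⟨d, ⟨hdab, ead, had⟩, hd⟩ : ∃ d ∈ s, d ∈ Ioc c' c := hsc.exists_between hc'.2
    refine ⟨ead.piecewiseLe ec d (had ⟨hdab.1, le_rfl⟩) (hc'e hd), subset_ite.2 ?_⟩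
    exact ⟨fun x hx => had ⟨hx.1.1, hx.2⟩, fun x hx => hc'e ⟨hd.1.trans (not_le.1 hx.2), hx.1.2⟩⟩
  rcases hc.2.eq_or_lt with heq | hlt
  · exact ⟨ec, heq ▸ hec⟩
  obtain ⟨d, hdcb, hd⟩ : ∃ d ∈ Ioc c b, Ico c d ⊆ ec.baseSet :=
    (mem_nhdsGE_iff_exists_mem_Ioc_Ico_subset hlt).1
      (mem_nhdsWithin_of_mem_nhds <| IsOpen.mem_nhds ec.open_baseSet (hec ⟨hc.1, le_rfl⟩))
  have had : Ico a d ⊆ ec.baseSet := Ico_subset_Icc_union_Ico.trans (union_subset hec hd)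
  obtain ⟨d', hcd', hd'd⟩ := exists_between hdcb.1
  exact absurd (hsc.1 ⟨⟨hc.1.trans hcd'.le, hd'd.le.trans hdcb.2⟩, ec,
    (Icc_subset_Ico_right hd'd).trans had⟩) hcd'.not_ge

/-- All the fibers of a locally trivial fibration over the line are homeomorphic. -/
theorem IsLocallyTrivialFibration.exists_trivialization {X : Type*} [TopologicalSpace X]
    {π : X → ℝ} (h : IsLocallyTrivialFibration π) (x₀ x : ℝ) :
    ∃ e : Bundle.Trivialization (π ⁻¹' {x₀}) π, x ∈ e.baseSet := by
  have key : IsClopen {x | ∃ e : Bundle.Trivialization (π ⁻¹' {x₀}) π, x ∈ e.baseSet} := by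
    refine ⟨isOpen_compl_iff.1 (isOpen_iff_mem_nhds.2 fun x hx => ?_),
      isOpen_iff_mem_nhds.2 fun x ⟨e, he⟩ => ?_⟩
    · obtain ⟨e, he⟩ := h x
      filter_upwards [e.open_baseSet.mem_nhds he] with y hy hy'
      obtain ⟨e', he'⟩ := hy'
      exact hx ⟨e.transFiberHomeomorph ((e.preimageSingletonHomeomorph hy).symm.trans
        (e'.preimageSingletonHomeomorph he')), he⟩
    · filter_upwards [e.open_baseSet.mem_nhds he] with y hy using ⟨e, hy⟩
  have := key.eq_univ ⟨x₀, h x₀⟩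
  exact this.ge (mem_univ x)

/-- A sequence indexed by the integers can be defined by its quotients. -/
theorem exists_int_sequence {G : Type*} [Group G] (t : ℤ → G) :
    ∃ φ : ℤ → G, ∀ n, φ (n + 1) = φ n * t n := by
  let a : ℕ → G := fun n => Nat.rec 1 (fun i x => x * t i) n
  let b : ℕ → G := fun n => Nat.rec 1 (fun i x => x * (t (-(i + 1 : ℤ)))⁻¹) n
  refine ⟨fun n => if 0 ≤ n then a n.toNat else b (-n).toNat, fun n => ?_⟩
  rcases le_or_gt 0 n with hn | hn
  · lift n to ℕ using hn
    simp only []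
    rw [if_pos (by omega), if_pos (by omega), show ((n : ℤ) + 1).toNat = n + 1 by omega]
    rfl
  · obtain ⟨m, rfl⟩ : ∃ m : ℕ, n = -(m + 1 : ℤ) := ⟨(-n - 1).toNat, by omega⟩
    have hb : b (m + 1) * t (-(m + 1 : ℤ)) = b m := by
      show b m * (t (-(m + 1 : ℤ)))⁻¹ * _ = _
      group
    simp only []
    rw [if_neg (by omega : ¬ (0 : ℤ) ≤ -(m + 1 : ℤ)),
      show (-(-(m + 1 : ℤ))).toNat = m + 1 by omega, hb]
    rcases Nat.eq_zero_or_pos m with rfl | hm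
    · simp [a, b]
    · rw [if_neg (by omega)]
      congr 1
      omega

/-- A locally trivial fibration over the line is trivial: trivializations over the intervals
`[n, n + 1]`, corrected by homeomorphisms of the fiber so that they agree over the integers, are
glued together. -/
theorem exists_homeomorph_prod_of_forall_trivialization {X F : Type*} [TopologicalSpace X]
    [TopologicalSpace F] {π : X → ℝ}
    (h : ∀ x, ∃ e : Bundle.Trivialization F π, x ∈ e.baseSet) :
    ∃ k : X ≃ₜ ℝ × F, ∀ p, (k p).1 = π p := by
  choose e he using fun n : ℤ => exists_trivialization_Icc_subset h n (n + 1)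
  have hl : ∀ n : ℤ, (n : ℝ) ∈ (e n).baseSet := fun n => he n ⟨le_rfl, by linarith⟩
  have hr : ∀ n : ℤ, ((n + 1 : ℤ) : ℝ) ∈ (e n).baseSet := fun n =>
    he n ⟨by push_cast; linarith, by push_cast; linarith⟩
  obtain ⟨φ, hφ⟩ := exists_int_sequence (G := F ≃ₜ F)
    fun n => (e (n + 1)).coordChangeHomeomorph (e n) (hl (n + 1)) (hr n)
  let e' : ∀ n : ℤ, Bundle.Trivialization F π := fun n => (e n).transFiberHomeomorph (φ n)
  have he' : ∀ n : ℤ, Icc (n : ℝ) (n + 1) ⊆ (e' n).baseSet := he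
  have hmatch : ∀ (n : ℤ) p, π p = (n + 1 : ℤ) → e' (n + 1) p = e' n p := by
    intro n p hp
    have h1 : π p ∈ (e (n + 1)).baseSet := hp ▸ hl (n + 1)
    have h2 : π p ∈ (e n).baseSet := hp ▸ hr n
    simp only [e', Bundle.Trivialization.transFiberHomeomorph_apply, hφ]
    rw [(e (n + 1)).coe_fst' h1, (e n).coe_fst' h2]
    congr 1
    show φ n ((e (n + 1)).coordChange (e n) ((n + 1 : ℤ) : ℝ) (e (n + 1) p).2) = _
    rw [← hp, Bundle.Trivialization.coordChange_apply_snd _ _ h1]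
  have hfl : ∀ (n : ℤ) x, x ∈ Icc (n : ℝ) (n + 1) → ⌊x⌋ = n ∨ (⌊x⌋ = n + 1 ∧ x = (n + 1 : ℤ)) := by
    intro n x hx
    rcases hx.2.eq_or_lt with h | h
    · right; subst h; exact ⟨by exact_mod_cast Int.floor_intCast (n + 1), by push_cast; rfl⟩
    · left; exact Int.floor_eq_iff.2 ⟨hx.1, h⟩
  have hmem : ∀ x : ℝ, x ∈ Icc (⌊x⌋ : ℝ) (⌊x⌋ + 1) := fun x =>
    ⟨Int.floor_le x, (Int.lt_floor_add_one x).le⟩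
  have hfun : ∀ (n : ℤ) p, π p ∈ Icc (n : ℝ) (n + 1) → e' ⌊π p⌋ p = e' n p := by
    intro n p hp
    rcases hfl n _ hp with h | ⟨h, h'⟩
    · rw [h]
    · rw [h, hmatch n p h']
  have hinv : ∀ (n : ℤ) (q : ℝ × F), q.1 ∈ Icc (n : ℝ) (n + 1) →
      (e' ⌊q.1⌋).toOpenPartialHomeomorph.symm q = (e' n).toOpenPartialHomeomorph.symm q := by
    intro n q hq
    rcases hfl n _ hq with h | ⟨h, h'⟩
    · rw [h]
    · have h1 : q ∈ (e' (n + 1)).target :=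
        (Bundle.Trivialization.mem_target _).2 (h' ▸ hl (n + 1))
      have h2 : q ∈ (e' n).target := (Bundle.Trivialization.mem_target _).2 (he' n hq)
      rw [h]
      have h3 : e' n ((e' (n + 1)).toOpenPartialHomeomorph.symm q) = q := by
        rw [← hmatch n _ (by rw [Bundle.Trivialization.proj_symm_apply _ h1, h']),
          Bundle.Trivialization.apply_symm_apply _ h1]
      rw [← (e' n).left_inv (x := (e' (n + 1)).toOpenPartialHomeomorph.symm q)
        ((Bundle.Trivialization.mem_source _).2
          (by rw [Bundle.Trivialization.proj_symm_apply _ h1]; exact he' n hq))]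
      exact congrArg _ h3
  have hlf : LocallyFinite fun n : ℤ => Icc (n : ℝ) (n + 1) := by
    intro x
    refine ⟨_, Metric.ball_mem_nhds x one_pos, (Set.finite_Icc ⌊x - 2⌋ ⌈x + 1⌉).subset ?_⟩
    rintro n ⟨y, hy, hyx⟩
    rw [Metric.mem_ball, Real.dist_eq, abs_lt] at hyx
    constructor
    · have : x - 2 < n := by linarith [hy.2, hyx.1]
      exact_mod_cast (Int.floor_le _).trans this.le
    · have : (n : ℝ) < x + 1 := by linarith [hy.1, hyx.2]
      exact_mod_cast this.le.trans (Int.le_ceil _)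
  have hπ : Continuous π := continuous_iff_continuousAt.2 fun p => by
    obtain ⟨e, he⟩ := h (π p)
    exact e.continuousAt_proj (e.mem_source.2 he)
  refine ⟨⟨⟨fun p => e' ⌊π p⌋ p, fun q => (e' ⌊q.1⌋).toOpenPartialHomeomorph.symm q,
    fun p => ?_, fun q => ?_⟩, ?_, ?_⟩, fun p => ?_⟩
  · have hs : p ∈ (e' ⌊π p⌋).source := (Bundle.Trivialization.mem_source _).2 (he' _ (hmem _))
    simp only [(e' ⌊π p⌋).coe_fst hs]
    exact (e' ⌊π p⌋).left_inv hs
  · have ht : q ∈ (e' ⌊q.1⌋).target := (Bundle.Trivialization.mem_target _).2 (he' _ (hmem _))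
    simp only [(e' ⌊q.1⌋).proj_symm_apply ht]
    exact (e' ⌊q.1⌋).apply_symm_apply ht
  · refine (hlf.preimage_continuous hπ).continuous
      (eq_univ_of_forall fun p => mem_iUnion.2 ⟨_, hmem (π p)⟩)
      (fun n => isClosed_Icc.preimage hπ) fun n => ?_
    refine ContinuousOn.congr ?_ fun p hp => hfun n p hp
    exact (e' n).continuousOn_toFun.mono fun p hp =>
      (Bundle.Trivialization.mem_source _).2 (he' n hp)
  · refine (hlf.preimage_continuous continuous_fst).continuous
      (eq_univ_of_forall fun q => mem_iUnion.2 ⟨_, hmem q.1⟩)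
      (fun n => isClosed_Icc.preimage continuous_fst) fun n => ?_
    refine ContinuousOn.congr ?_ fun q hq => hinv n q hq
    exact (e' n).continuousOn_invFun.mono fun q hq =>
      (Bundle.Trivialization.mem_target _).2 (he' n hq)
  · exact (e' ⌊π p⌋).coe_fst' (he' _ (hmem _))

/-! ### Separation of the plane by the lines of a product structure -/

/-- Every nonvanishing continuous function on the punctured plane is the product of a power of the
coordinate and of an exponential. -/
theorem exists_eq_zpow_mul_exp {f : ℂ → ℂ} (hf : ContinuousOn f {0}ᶜ) (h0 : ∀ w ≠ 0, f w ≠ 0) :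
    ∃ (n : ℤ) (ψ : ℂ → ℂ), ContinuousOn ψ {0}ᶜ ∧ ∀ w ≠ 0, f w = w ^ n * Complex.exp (ψ w) := by
  have hfe : Continuous fun z => f (Complex.exp z) :=
    hf.comp_continuous Complex.continuous_exp fun z => Complex.exp_ne_zero z
  obtain ⟨g, hg, hfg, n, hn⟩ := exists_log_comp_exp (f := fun x : ℂ × ℂ => f (Complex.exp x.2))
    (hfe.comp continuous_snd) (fun x => h0 _ (Complex.exp_ne_zero _))
    (fun a z => by simp only [exp_add_two_pi_I])
  -- `g - n z` is periodic, so that it descends to the punctured plane; any branch of the logarithm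
  -- can be used to write the function down
  let ψ : ℂ → ℂ := fun w => g (0, Complex.log w) - n * Complex.log w
  have hper : ∀ z z', Complex.exp z = Complex.exp z' → g (0, z) - n * z = g (0, z') - n * z' := by
    have key : ∀ (k : ℕ) z, g (0, z + k * (2 * Real.pi * Complex.I)) =
        g (0, z) + n * (k * (2 * Real.pi * Complex.I)) := by
      intro k
      induction k with
      | zero => simp
      | succ i hi =>
        intro z
        rw [show z + ((i + 1 : ℕ) : ℂ) * (2 * Real.pi * Complex.I) =
          z + i * (2 * Real.pi * Complex.I) + 2 * Real.pi * Complex.I by push_cast; ring, hn, hi]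
        push_cast; ring
    intro z z' h
    obtain ⟨k, hk⟩ := Complex.exp_eq_exp_iff_exists_int.1 h
    obtain ⟨j, rfl | rfl⟩ := k.eq_nat_or_neg
    · have := key j z'
      rw [hk]
      push_cast at this ⊢
      rw [this]; ring
    · have h2 : z' = z + j * (2 * Real.pi * Complex.I) := by rw [hk]; push_cast; ring
      rw [h2, key]; ring
  have hψe : ∀ z, ψ (Complex.exp z) = g (0, z) - n * z := fun z =>
    hper _ _ (Complex.exp_log (Complex.exp_ne_zero z))
  refine ⟨n, ψ, ?_, fun w hw => ?_⟩
  · rw [continuousOn_iff_continuous_domRestrict]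
    have hq : IsQuotientMap fun z : ℂ =>
        (⟨Complex.exp z, Complex.exp_ne_zero z⟩ : {z : ℂ // z ≠ 0}) :=
      Complex.isCoveringMap_exp.isLocalHomeomorph.isOpenMap.isQuotientMap
        Complex.isCoveringMap_exp.continuous (fun w =>
          ⟨Complex.log w, Subtype.ext (Complex.exp_log w.2)⟩)
    have : Continuous fun w : {z : ℂ // z ≠ 0} => ψ w := by
      rw [hq.continuous_iff]
      have : ((fun w : {z : ℂ // z ≠ 0} => ψ w) ∘ fun z : ℂ =>
        (⟨Complex.exp z, Complex.exp_ne_zero z⟩ : {z : ℂ // z ≠ 0})) =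
        fun z => g (0, z) - n * z := funext hψe
      rw [this]
      fun_prop
    exact this
  · have h1 := hfg (0, Complex.log w)
    simp only [Complex.exp_log hw] at h1
    rw [h1]
    simp only [ψ]
    rw [Complex.exp_sub, Complex.exp_int_mul, Complex.exp_log hw,
      mul_div_cancel₀ _ (zpow_ne_zero n hw)]

theorem not_exists_log_punctured_plane {ψ : ℂ → ℂ} (hψ : ContinuousOn ψ {0}ᶜ) :
    ¬ ∀ w ≠ 0, w = Complex.exp (ψ w) := by
  intro h
  have := log_increment_unique (g := fun z => ψ (Complex.exp z)) (g' := id) (n := 0) (m := 1)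
    (hψ.comp_continuous Complex.continuous_exp fun z => Complex.exp_ne_zero z) continuous_id
    (fun z => (h _ (Complex.exp_ne_zero z)).symm) (by simp [exp_add_two_pi_I]) (by simp)
  simp at this

theorem contractibleSpace_of_prod_homeomorph {F : Type*} [TopologicalSpace F] (h : F × ℝ ≃ₜ ℂ) :
    ContractibleSpace F := by
  rw [contractible_iff_id_nullhomotopic]
  have : ContractibleSpace (F × ℝ) := h.contractibleSpace_iff.2 inferInstance
  exact ((id_nullhomotopic (F × ℝ)).comp_right ContinuousMap.fst).comp_left
    (ContinuousMap.mk (fun a : F => (a, (0 : ℝ))))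

/-- For all `p` simultaneously, `h (a, s) - h (p, 0)` has a continuous logarithm on the slit plane
where the point `(p, 0)` and the half of the line `{p} × ℝ` on the side opposite to `ε` are
removed: pushing `s` to `ε` retracts this set onto the contractible space `F × F × {ε}`. -/
theorem exists_log_slit {F : Type*} [TopologicalSpace F] (h : F × ℝ ≃ₜ ℂ)
    {ε : ℝ} (hε : ε ≠ 0) :
    ∃ L : F × F × ℝ → ℂ, ContinuousOn L {x | x.1 ≠ x.2.1 ∨ 0 < ε * x.2.2} ∧
      ∀ x ∈ {x : F × F × ℝ | x.1 ≠ x.2.1 ∨ 0 < ε * x.2.2},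
        h x.2 - h (x.1, 0) = Complex.exp (L x) := by
  have := contractibleSpace_of_prod_homeomorph h
  have hε2 : 0 < ε * ε := mul_self_pos.2 hε
  obtain ⟨g, hg, hfg⟩ := exists_log_of_contractible (A := F × F)
    (f := fun x => h (x.2, ε) - h (x.1, 0)) (by fun_prop)
    (fun x => sub_ne_zero.2 (by simp [h.injective.eq_iff, hε]))
  set S := {x : F × F × ℝ | x.1 ≠ x.2.1 ∨ 0 < ε * x.2.2}
  obtain ⟨G, hG, hfG⟩ := exists_log_of_homotopy
    (H := fun x : unitInterval × S =>
      h (x.2.1.2.1, (1 - (x.1 : ℝ)) * ε + x.1 * x.2.1.2.2) - h (x.2.1.1, 0)) (by fun_prop)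
    (fun x => by
      rw [sub_ne_zero, h.injective.ne_iff]
      intro heq
      simp only [Prod.mk.injEq] at heq
      rcases x.2.2 with h1 | h1
      · exact h1 heq.1.symm
      · have h3 : (1 - (x.1 : ℝ)) * (ε * ε) + x.1 * (ε * x.2.1.2.2) = 0 := by
          linear_combination ε * heq.2
        rcases x.1.2.1.eq_or_lt with h4 | h4
        · rw [← h4] at h3
          linarith
        · have := mul_pos h4 h1
          have := mul_nonneg (sub_nonneg.2 x.1.2.2) hε2.le
          linarith)
    (g := fun x : S => g (x.1.1, x.1.2.1)) (by fun_prop) (fun a => by simp [← hfg])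
  classical
  refine ⟨fun x => if hx : x ∈ S then G (1, ⟨x, hx⟩) else 0, ?_, fun x hx => ?_⟩
  · rw [continuousOn_iff_continuous_domRestrict]
    have : S.domRestrict (fun x => if hx : x ∈ S then G (1, ⟨x, hx⟩) else 0) =
        fun x => G (1, x) := by
      ext x
      simp [Set.domRestrict]
    rw [this]
    fun_prop
  · simp only [hx, dif_pos]
    rw [← hfG]
    simp

theorem isPreconnected_slit {F : Type*} [TopologicalSpace F] (h : F × ℝ ≃ₜ ℂ)
    (p : F) {ε : ℝ} (hε : ε ≠ 0) :
    IsPreconnected {y : F × ℝ | p ≠ y.1 ∨ 0 < ε * y.2} := by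
  have := contractibleSpace_of_prod_homeomorph h
  have hε2 : 0 < ε * ε := mul_self_pos.2 hε
  refine isPreconnected_of_forall (p, ε) fun y hy => ?_
  refine ⟨(fun a : F => (a, ε)) '' univ ∪ (fun s : ℝ => (y.1, s)) '' segment ℝ ε y.2, ?_,
    .inl ⟨p, trivial, rfl⟩, .inr ⟨y.2, right_mem_segment _ _ _, rfl⟩, ?_⟩
  · rintro _ (⟨a, -, rfl⟩ | ⟨s, hs, rfl⟩)
    · exact .inr hε2
    · rcases hy with hy | hy
      · exact .inl hy
      · refine .inr ?_
        exact (convex_halfSpace_gt (f := fun s : ℝ => ε * s)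
          (IsLinearMap.mk (by intros; ring) (by intros; simp; ring)) 0).segment_subset hε2 hy hs
  · exact IsPreconnected.union (y.1, ε) ⟨y.1, trivial, rfl⟩ ⟨ε, left_mem_segment _ _ _, rfl⟩
      (isPreconnected_univ.image _ (by fun_prop))
      ((convex_segment _ _).isPreconnected.image _ (by fun_prop))

/-- The jump `c (p, a)`, for `p ≠ a`, is the difference along the line `{a} × ℝ` between the
logarithms of `h (a, s) - h (p, 0)` on the two slit planes of `exists_log_slit`, for `ε = 1` and
`ε = -1`. It is locally constant and tells on which side of the line `{p} × ℝ` the line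
`{a} × ℝ` lies. -/
theorem exists_log_jump {F : Type*} [TopologicalSpace F] (h : F × ℝ ≃ₜ ℂ) :
    ∃ (L₁ L₂ : F × F × ℝ → ℂ) (c : F × F → ℤ),
      ContinuousOn L₁ {x | x.1 ≠ x.2.1 ∨ 0 < 1 * x.2.2} ∧
      ContinuousOn L₂ {x | x.1 ≠ x.2.1 ∨ 0 < -1 * x.2.2} ∧
      (∀ x ∈ {x : F × F × ℝ | x.1 ≠ x.2.1 ∨ 0 < 1 * x.2.2},
        h x.2 - h (x.1, 0) = Complex.exp (L₁ x)) ∧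
      (∀ x ∈ {x : F × F × ℝ | x.1 ≠ x.2.1 ∨ 0 < -1 * x.2.2},
        h x.2 - h (x.1, 0) = Complex.exp (L₂ x)) ∧
      ContinuousOn c {x | x.1 ≠ x.2} ∧
      ∀ p a s, p ≠ a → L₁ (p, a, s) = L₂ (p, a, s) + c (p, a) * (2 * Real.pi * Complex.I) := by
  obtain ⟨L₁, hL₁, hW₁⟩ := exists_log_slit h (one_ne_zero (α := ℝ))
  obtain ⟨L₂, hL₂, hW₂⟩ := exists_log_slit h (neg_ne_zero.2 (one_ne_zero (α := ℝ)))
  let S : Set (F × F) := {x | x.1 ≠ x.2}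
  have hι : Continuous fun x : S × ℝ => (x.1.1.1, x.1.1.2, x.2) := by fun_prop
  obtain ⟨k, hk, hkL⟩ := exists_int_of_exp_eq
    (g₁ := fun x : S × ℝ => L₁ (x.1.1.1, x.1.1.2, x.2))
    (g₂ := fun x : S × ℝ => L₂ (x.1.1.1, x.1.1.2, x.2))
    (hL₁.comp_continuous hι fun x => .inl x.1.2) (hL₂.comp_continuous hι fun x => .inl x.1.2)
    (fun x => (hW₁ (x.1.1.1, x.1.1.2, x.2) (.inl x.1.2)).symm.trans
      (hW₂ (x.1.1.1, x.1.1.2, x.2) (.inl x.1.2)))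
  classical
  refine ⟨L₁, L₂, fun x => if hx : x ∈ S then k (⟨x, hx⟩, 0) else 0, hL₁, hL₂, hW₁, hW₂, ?_,
    fun p a s hpa => ?_⟩
  · rw [continuousOn_iff_continuous_domRestrict]
    have : S.domRestrict (fun x => if hx : x ∈ S then k (⟨x, hx⟩, 0) else 0) =
        fun x => k (x, 0) := by
      ext x
      simp [Set.domRestrict]
    exact this ▸ (by fun_prop : Continuous fun x : S => k (x, 0))
  · have hmem : (p, a) ∈ S := hpa
    rw [hkL (⟨(p, a), hmem⟩, s)]
    simp only [hmem, dif_pos]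
    rw [PreconnectedSpace.constant (f := fun s : ℝ => k (⟨(p, a), hmem⟩, s)) inferInstance
      (by fun_prop) (x := s) (y := 0)]

theorem isOpen_slit {F : Type*} [TopologicalSpace F] [T1Space F] (p : F) (ε : ℝ) :
    IsOpen {y : F × ℝ | p ≠ y.1 ∨ 0 < ε * y.2} := by
  have h1 : IsOpen {y : F × ℝ | p ≠ y.1} := by
    simp_rw [ne_comm (a := p)]
    exact isOpen_ne.preimage continuous_fst
  have h2 : IsOpen {y : F × ℝ | 0 < ε * y.2} :=
    isOpen_lt continuous_const (continuous_const.mul continuous_snd)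
  exact h1.union h2

theorem mem_slit_or_mem_slit {F : Type*} {p : F} {y : F × ℝ} (hy : y ≠ (p, 0)) :
    (p ≠ y.1 ∨ 0 < 1 * y.2) ∨ (p ≠ y.1 ∨ 0 < -1 * y.2) := by
  by_cases h1 : p = y.1
  · rcases lt_trichotomy y.2 0 with h2 | h2 | h2
    · exact .inr (.inr (by linarith))
    · exact absurd (Prod.ext h1.symm h2) hy
    · exact .inl (.inr (by linarith))
  · exact .inl (.inl h1)

/-- The jump cannot be constant on `{a | a ≠ p}`: otherwise the two logarithms would be glued to
a logarithm of the coordinate on the punctured plane. -/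
theorem log_jump_not_constant {F : Type*} [TopologicalSpace F] [T1Space F] (h : F × ℝ ≃ₜ ℂ) (p : F)
    {L₁ L₂ : F × ℝ → ℂ} (hL₁ : ContinuousOn L₁ {y | p ≠ y.1 ∨ 0 < 1 * y.2})
    (hL₂ : ContinuousOn L₂ {y | p ≠ y.1 ∨ 0 < -1 * y.2})
    (hW₁ : ∀ y ∈ {y : F × ℝ | p ≠ y.1 ∨ 0 < 1 * y.2}, h y - h (p, 0) = Complex.exp (L₁ y))
    (hW₂ : ∀ y ∈ {y : F × ℝ | p ≠ y.1 ∨ 0 < -1 * y.2}, h y - h (p, 0) = Complex.exp (L₂ y))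
    {c : F → ℤ} (hc : ∀ a s, p ≠ a → L₁ (a, s) = L₂ (a, s) + c a * (2 * Real.pi * Complex.I))
    (k : ℤ) : ∃ a, p ≠ a ∧ c a ≠ k := by
  by_contra! hk
  classical
  set U := {y : F × ℝ | p ≠ y.1 ∨ 0 < 1 * y.2}
  set V := {y : F × ℝ | p ≠ y.1 ∨ 0 < -1 * y.2}
  let l : F × ℝ → ℂ := fun y => if y ∈ U then L₁ y else L₂ y + k * (2 * Real.pi * Complex.I)
  have hlU : ContinuousOn l U := hL₁.congr fun y hy => if_pos hy
  have hlV : EqOn l (fun y => L₂ y + k * (2 * Real.pi * Complex.I)) V := fun y hy => by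
    by_cases hyU : y ∈ U
    · have hp : p ≠ y.1 := by
        rcases hyU with h1 | h1
        · exact h1
        · rcases hy with h2 | h2
          · exact h2
          · linarith
      simp only [l, if_pos hyU]
      rw [← hk _ hp, ← hc _ _ hp]
    · simp [l, hyU]
  have hl : ContinuousOn l (U ∪ V) := hlU.union_of_isOpen
    ((hL₂.add continuousOn_const).congr hlV) (isOpen_slit p 1) (isOpen_slit p (-1))
  have hlexp : ∀ y, y ≠ (p, 0) → h y - h (p, 0) = Complex.exp (l y) := fun y hy => by
    rcases mem_slit_or_mem_slit hy with h1 | h1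
    · rw [hW₁ y h1]
      exact congrArg _ (if_pos (c := y ∈ U) h1).symm
    · rw [hlV h1, Complex.exp_add, Complex.exp_int_mul_two_pi_mul_I, mul_one, hW₂ y h1]
  have hne : ∀ w : ℂ, w ≠ 0 → h.symm (w + h (p, 0)) ≠ (p, 0) := fun w hw heq => by
    have := congrArg h heq
    simp [hw] at this
  refine not_exists_log_punctured_plane (ψ := fun w => l (h.symm (w + h (p, 0)))) ?_ fun w hw => ?_
  · exact hl.comp (by fun_prop) fun w hw => mem_slit_or_mem_slit (hne w hw)
  · rw [← hlexp _ (hne w hw)]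
    simp

/-- A locally constant integral function `d` on `{a | a ≠ p}`, with values in `{-1, 0, 1}`, is an
affine function of the jump: this is the Mayer-Vietoris sequence of the two slit planes, whose union
is the punctured plane. With `d = u - v`, where `u` and `v` are continuous on the slit planes, the
functions `exp (2πi u)` and `exp (2πi v)` define a function `G` on the punctured plane, of some
degree `n`, and comparing `G` with the power `n` of the coordinate gives the coefficients. -/
theorem eq_mul_log_jump_add_const {F : Type*} [TopologicalSpace F] [T1Space F] (h : F × ℝ ≃ₜ ℂ)
    (p : F) {L₁ L₂ : F × ℝ → ℂ} (hL₁ : ContinuousOn L₁ {y | p ≠ y.1 ∨ 0 < 1 * y.2})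
    (hL₂ : ContinuousOn L₂ {y | p ≠ y.1 ∨ 0 < -1 * y.2})
    (hW₁ : ∀ y ∈ {y : F × ℝ | p ≠ y.1 ∨ 0 < 1 * y.2}, h y - h (p, 0) = Complex.exp (L₁ y))
    (hW₂ : ∀ y ∈ {y : F × ℝ | p ≠ y.1 ∨ 0 < -1 * y.2}, h y - h (p, 0) = Complex.exp (L₂ y))
    {c : F → ℤ} (hc : ∀ a s, p ≠ a → L₁ (a, s) = L₂ (a, s) + c a * (2 * Real.pi * Complex.I))
    {d : F → ℤ} (hd : ContinuousOn d {a | p ≠ a}) (hd1 : ∀ a, |d a| ≤ 1) :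
    ∃ n k : ℤ, ∀ a, p ≠ a → d a = n * c a + k := by
  set U := {y : F × ℝ | p ≠ y.1 ∨ 0 < 1 * y.2} with hU
  set V := {y : F × ℝ | p ≠ y.1 ∨ 0 < -1 * y.2} with hV
  -- a cutoff function, equal to `0` on the upper half of the line `{p} × ℝ` and to `1` on the lower
  let δ : F → ℝ := fun a => ‖h (a, 0) - h (p, 0)‖
  have hδ0 : ∀ a, p ≠ a → 0 < δ a := fun a ha => by
    simp [δ, sub_eq_zero, h.injective.eq_iff, ha.symm]
  have hδp : δ p = 0 := by simp [δ]
  have hδnn : ∀ a, 0 ≤ δ a := fun a => norm_nonneg _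
  let χ : F × ℝ → ℝ := fun y => (max (-y.2) 0 + δ y.1 / 2) / (|y.2| + δ y.1)
  have hden : ∀ y : F × ℝ, y ≠ (p, 0) → |y.2| + δ y.1 ≠ 0 := fun y hy => by
    rcases mem_slit_or_mem_slit hy with (h1 | h1) | (h1 | h1)
    · have := hδ0 _ h1
      positivity
    · have h2 : y.2 ≠ 0 := fun h2 => by simp [h2] at h1
      have := hδnn y.1
      positivity
    · have := hδ0 _ h1
      positivity
    · have h2 : y.2 ≠ 0 := fun h2 => by simp [h2] at h1
      have := hδnn y.1
      positivity
  have hχ : ∀ y : F × ℝ, y ≠ (p, 0) → ContinuousAt χ y := fun y hy => by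
    refine ContinuousAt.div ?_ ?_ (hden y hy)
    · exact Continuous.continuousAt (by fun_prop)
    · exact Continuous.continuousAt (by fun_prop)
  have hχ0 : ∀ s : ℝ, 0 < s → χ (p, s) = 0 := fun s hs => by
    simp [χ, hδp, hs.le]
  have hχ1 : ∀ s : ℝ, s < 0 → χ (p, s) = 1 := fun s hs => by
    simp [χ, hδp, hs.le, abs_of_neg hs, div_self (neg_ne_zero.2 hs.ne)]
  -- the product of `d` with a function vanishing on the rest of the line is continuous
  have hmul : ∀ {S : Set (F × ℝ)} {f : F × ℝ → ℝ}, (∀ y ∈ S, ContinuousAt f y) →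
      (∀ y ∈ S, p = y.1 → f y = 0) → ContinuousOn (fun y => (d y.1 : ℝ) * f y) S := by
    intro S f hf hf0 y hy
    refine ContinuousAt.continuousWithinAt ?_
    by_cases hp : p = y.1
    · have h1 : Tendsto f (𝓝 y) (𝓝 0) := by
        have := hf y hy
        rwa [ContinuousAt, hf0 y hy hp] at this
      have h2 : Tendsto (fun y => (d y.1 : ℝ) * f y) (𝓝 y) (𝓝 0) := by
        refine squeeze_zero_norm (fun y => ?_) (by simpa using h1.norm)
        rw [norm_mul]
        refine mul_le_of_le_one_left (norm_nonneg _) ?_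
        rw [Real.norm_eq_abs]
        exact_mod_cast hd1 y.1
      rw [ContinuousAt]
      simpa [hf0 y hy hp] using h2
    · have hopen : IsOpen {a | p ≠ a} := by
        have : {a | p ≠ a} = {p}ᶜ := by ext; simp [eq_comm]
        rw [this]; exact isOpen_compl_singleton
      have h1 : ContinuousAt d y.1 := hd.continuousAt (hopen.mem_nhds hp)
      have h2 : ContinuousAt (fun a => (d a : ℝ)) y.1 :=
        (continuous_of_discreteTopology (f := fun n : ℤ => (n : ℝ))).continuousAt.comp h1
      exact (h2.comp continuousAt_fst).mul (hf y hy)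
  have hUne : ∀ y ∈ U, y ≠ (p, 0) := by
    rintro y (h1 | h1) rfl <;> simp at h1
  have hVne : ∀ y ∈ V, y ≠ (p, 0) := by
    rintro y (h1 | h1) rfl <;> simp at h1
  let u : F × ℝ → ℝ := fun y => d y.1 * χ y
  let v : F × ℝ → ℝ := fun y => d y.1 * (χ y - 1)
  have hu : ContinuousOn u U := hmul (fun y hy => hχ y (hUne y hy)) (by
    rintro ⟨a, s⟩ (h1 | h1) rfl
    · exact absurd rfl h1
    · exact hχ0 s (by simpa using h1))
  have hv : ContinuousOn v V := hmul
    (fun y hy => (hχ y (hVne y hy)).sub continuousAt_const) (by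
    rintro ⟨a, s⟩ (h1 | h1) rfl
    · exact absurd rfl h1
    · simp [hχ1 s (by simpa using h1)])
  let G : F × ℝ → ℂ := fun y => Complex.exp (u y * (2 * Real.pi * Complex.I))
  have hGV : ∀ y, G y = Complex.exp (v y * (2 * Real.pi * Complex.I)) := fun y => by
    have : (v y : ℂ) * (2 * Real.pi * Complex.I) =
      u y * (2 * Real.pi * Complex.I) - d y.1 * (2 * Real.pi * Complex.I) := by
      simp only [u, v]; push_cast; ring
    rw [this, Complex.exp_sub, Complex.exp_int_mul_two_pi_mul_I, div_one]
  have hG : ContinuousOn G (U ∪ V) := by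
    refine ContinuousOn.union_of_isOpen ?_ ?_ (isOpen_slit p 1) (isOpen_slit p (-1))
    · exact Complex.continuous_exp.comp_continuousOn
        ((Complex.continuous_ofReal.comp_continuousOn hu).mul continuousOn_const)
    · refine ContinuousOn.congr ?_ fun y hy => hGV y
      exact Complex.continuous_exp.comp_continuousOn
        ((Complex.continuous_ofReal.comp_continuousOn hv).mul continuousOn_const)
  have hne : ∀ w : ℂ, w ≠ 0 → h.symm (w + h (p, 0)) ≠ (p, 0) := fun w hw heq => by
    have := congrArg h heq
    simp [hw] at this
  obtain ⟨n, ψ, hψ, hGψ⟩ := exists_eq_zpow_mul_exp (f := fun w => G (h.symm (w + h (p, 0))))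
    (hG.comp (by fun_prop) fun w hw => mem_slit_or_mem_slit (hne w hw))
    (fun w hw => Complex.exp_ne_zero _)
  let ψ' : F × ℝ → ℂ := fun y => ψ (h y - h (p, 0))
  have hψ'0 : ∀ y, y ≠ (p, 0) → h y - h (p, 0) ≠ 0 := fun y hy =>
    sub_ne_zero.2 (h.injective.ne hy)
  have hψ' : ∀ S : Set (F × ℝ), (∀ y ∈ S, y ≠ (p, 0)) → ContinuousOn ψ' S := fun S hS =>
    hψ.comp (by fun_prop) fun y hy => hψ'0 y (hS y hy)
  have hGψ' : ∀ y, y ≠ (p, 0) → G y = (h y - h (p, 0)) ^ n * Complex.exp (ψ' y) := fun y hy => by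
    have := hGψ _ (hψ'0 y hy)
    simpa using this
  -- on each slit plane, two logarithms of `G` differ by a constant
  have hconst : ∀ {S : Set (F × ℝ)} {L : F × ℝ → ℂ} {f : F × ℝ → ℝ}, IsPreconnected S →
      (∀ y ∈ S, y ≠ (p, 0)) → ContinuousOn L S → ContinuousOn f S →
      (∀ y ∈ S, h y - h (p, 0) = Complex.exp (L y)) →
      (∀ y, G y = Complex.exp (f y * (2 * Real.pi * Complex.I))) →
      ∃ k : ℤ, ∀ y ∈ S, f y * (2 * Real.pi * Complex.I) =
        n * L y + ψ' y + k * (2 * Real.pi * Complex.I) := by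
    intro S L f hS hSne hL hf hW hGf
    have : PreconnectedSpace S := Subtype.preconnectedSpace hS
    obtain ⟨k, hk⟩ := exists_int_const_of_exp_eq
      (g₁ := fun y : S => (f y * (2 * Real.pi * Complex.I) : ℂ))
      (g₂ := fun y : S => n * L y + ψ' y)
      ((Complex.continuous_ofReal.comp (continuousOn_iff_continuous_domRestrict.1 hf)).mul
        continuous_const)
      ((continuous_const.mul (continuousOn_iff_continuous_domRestrict.1 hL)).add
        (continuousOn_iff_continuous_domRestrict.1 (hψ' S hSne)))
      (fun y => by
        rw [← hGf, hGψ' y (hSne y y.2), hW y y.2, Complex.exp_add, Complex.exp_int_mul])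
    exact ⟨k, fun y hy => hk ⟨y, hy⟩⟩
  obtain ⟨k₁, hk₁⟩ := hconst (isPreconnected_slit h p one_ne_zero) hUne hL₁ hu hW₁ fun y => rfl
  obtain ⟨k₂, hk₂⟩ := hconst (isPreconnected_slit h p (neg_ne_zero.2 one_ne_zero)) hVne hL₂ hv
    hW₂ hGV
  refine ⟨n, k₁ - k₂, fun a ha => ?_⟩
  have e1 := hk₁ (a, 0) (.inl ha)
  have e2 := hk₂ (a, 0) (.inl ha)
  have e3 := hc a 0 ha
  have e4 : (u (a, 0) : ℂ) - v (a, 0) = d a := by simp only [u, v]; push_cast; ring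
  have e5 : ((d a : ℂ) - (n * c a + (k₁ - k₂))) * (2 * Real.pi * Complex.I) = 0 := by
    rw [← e4]
    linear_combination e1 - e2 + n * e3
  have := (mul_eq_zero.1 e5).resolve_right Complex.two_pi_I_ne_zero
  exact_mod_cast sub_eq_zero.1 this

/-! ### Topological characterization of the line -/

/-- If `F × ℝ` is a plane, the lines `{p} × ℝ` have two sides, chosen coherently: `R p a` means that
`{a} × ℝ` is on the positive side of `{p} × ℝ`. The jump takes exactly two values, consecutive and
independent of `p`, and `R p a` says that it takes the greater one. -/
theorem exists_separating_relation {F : Type*} [TopologicalSpace F] [T1Space F]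
    (h : F × ℝ ≃ₜ ℂ) :
    ∃ R : F → F → Prop, IsOpen {x : F × F | x.1 ≠ x.2 ∧ R x.1 x.2} ∧
      IsOpen {x : F × F | x.1 ≠ x.2 ∧ ¬ R x.1 x.2} ∧
      (∀ p, ∃ a, p ≠ a ∧ R p a) ∧ ∀ p, ∃ a, p ≠ a ∧ ¬ R p a := by
  obtain ⟨L₁, L₂, c, hL₁, hL₂, hW₁, hW₂, hc, hL⟩ := exists_log_jump h
  have hopen : IsOpen {x : F × F | x.1 ≠ x.2} := by
    have hF : T2Space F := T2Space.of_injective_continuous (f := fun a : F => h (a, 0))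
      (fun a b hab => congrArg Prod.fst (h.injective hab)) (by fun_prop)
    exact isOpen_ne_fun continuous_fst continuous_snd
  have hι : ∀ p : F, Continuous fun y : F × ℝ => (p, y.1, y.2) := fun p => by fun_prop
  have hcp : ∀ p, ContinuousOn (fun a => c (p, a)) {a | p ≠ a} := fun p =>
    hc.comp (by fun_prop) fun a ha => ha
  have hnc : ∀ p (k : ℤ), ∃ a, p ≠ a ∧ c (p, a) ≠ k := fun p k =>
    log_jump_not_constant h p (L₁ := fun y => L₁ (p, y.1, y.2)) (L₂ := fun y => L₂ (p, y.1, y.2))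
      (hL₁.comp (hι p).continuousOn fun y hy => hy) (hL₂.comp (hι p).continuousOn fun y hy => hy)
      (fun y hy => hW₁ (p, y.1, y.2) hy) (fun y hy => hW₂ (p, y.1, y.2) hy)
      (c := fun a => c (p, a)) (fun a s ha => hL p a s ha) k
  have hMV : ∀ p (d : F → ℤ), ContinuousOn d {a | p ≠ a} → (∀ a, |d a| ≤ 1) →
      ∃ n k : ℤ, ∀ a, p ≠ a → d a = n * c (p, a) + k := fun p d hd hd1 =>
    eq_mul_log_jump_add_const h p (L₁ := fun y => L₁ (p, y.1, y.2))
      (L₂ := fun y => L₂ (p, y.1, y.2))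
      (hL₁.comp (hι p).continuousOn fun y hy => hy) (hL₂.comp (hι p).continuousOn fun y hy => hy)
      (fun y hy => hW₁ (p, y.1, y.2) hy) (fun y hy => hW₂ (p, y.1, y.2) hy)
      (c := fun a => c (p, a)) (fun a s ha => hL p a s ha) hd hd1
  have htwo : ∀ p, ∃ m : ℤ, (∀ a, p ≠ a → c (p, a) = m ∨ c (p, a) = m + 1) ∧
      (∃ a, p ≠ a ∧ c (p, a) = m) ∧ ∃ a, p ≠ a ∧ c (p, a) = m + 1 := by
    intro p
    obtain ⟨a₁, ha₁, -⟩ := hnc p 0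
    obtain ⟨a₂, ha₂, h12⟩ := hnc p (c (p, a₁))
    -- the indicator function of a level set of the jump is an affine function `n c + k` of the jump
    obtain ⟨n, k, hnk⟩ := hMV p (fun a => if c (p, a) = c (p, a₁) then 1 else 0)
      ((continuous_of_discreteTopology
        (f := fun i : ℤ => if i = c (p, a₁) then (1 : ℤ) else 0)).comp_continuousOn (hcp p))
      (fun a => by split_ifs <;> simp)
    have e1 := hnk a₁ ha₁
    have e2 := hnk a₂ ha₂
    rw [if_pos rfl] at e1
    rw [if_neg h12] at e2
    have e3 : n * (c (p, a₁) - c (p, a₂)) = 1 := by linarith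
    have hall : ∀ a, p ≠ a → c (p, a) = c (p, a₁) ∨ c (p, a) = c (p, a₂) := by
      intro a ha
      by_cases heq : c (p, a) = c (p, a₁)
      · exact .inl heq
      · right
        have e4 := hnk a ha
        rw [if_neg heq] at e4
        have hn : n ≠ 0 := by rintro rfl; simp at e3
        exact mul_left_cancel₀ hn (by linarith)
    rcases Int.mul_eq_one_iff_eq_one_or_neg_one.1 e3 with ⟨-, h5⟩ | ⟨-, h5⟩
    · exact ⟨c (p, a₂), fun a ha => by rcases hall a ha with h | h <;> omega, ⟨a₂, ha₂, rfl⟩,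
        a₁, ha₁, by omega⟩
    · exact ⟨c (p, a₁), fun a ha => by rcases hall a ha with h | h <;> omega, ⟨a₁, ha₁, rfl⟩,
        a₂, ha₂, by omega⟩
  choose m hm hm0 hm1 using htwo
  have hlc : IsLocallyConstant m := by
    refine (IsLocallyConstant.iff_eventually_eq m).2 fun p => ?_
    obtain ⟨a, ha, hca⟩ := hm0 p
    obtain ⟨b, hb, hcb⟩ := hm1 p
    have hev : ∀ a, p ≠ a → ∀ᶠ q in 𝓝 p, q ≠ a ∧ c (q, a) = c (p, a) := fun a ha => by
      have h1 : ContinuousAt (fun q => c (q, a)) p :=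
        (hc.continuousAt (hopen.mem_nhds (show (p, a) ∈ {x : F × F | x.1 ≠ x.2} from ha))).comp
          (f := fun q => (q, a)) (by fun_prop)
      have h2 : ∀ᶠ q in 𝓝 p, c (q, a) = c (p, a) := h1.eventually_mem
        (isOpen_discrete {c (p, a)} |>.mem_nhds rfl)
      exact (isOpen_ne.eventually_mem ha).and h2
    filter_upwards [hev a ha, hev b hb] with q hqa hqb
    have e1 := hm q a hqa.1
    have e2 := hm q b hqb.1
    omega
  have := contractibleSpace_of_prod_homeomorph h
  rcases isEmpty_or_nonempty F with hF | ⟨⟨p₀⟩⟩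
  · exact ⟨fun _ _ => True, by simp [Subsingleton.elim _ (∅ : Set (F × F))],
      by simp, fun p => hF.elim p, fun p => hF.elim p⟩
  have hm' : ∀ p, m p = m p₀ := fun p => hlc.apply_eq_of_isPreconnected isPreconnected_univ
    trivial trivial
  refine ⟨fun p a => c (p, a) = m p₀ + 1, ?_, ?_, fun p => ?_, fun p => ?_⟩
  · exact hc.isOpen_inter_preimage hopen (isOpen_discrete {m p₀ + 1})
  · exact hc.isOpen_inter_preimage hopen (isOpen_discrete {m p₀ + 1}ᶜ)
  · rw [← hm' p]
    exact hm1 p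
  · obtain ⟨a, ha, hca⟩ := hm0 p
    exact ⟨a, ha, by simp only [hca, hm' p]; omega⟩

/-- In a connected space, if `{p}ᶜ` is the union of disjoint open sets `A` and `B` and `A` is not
empty, then `A` accumulates at `p`. -/
theorem mem_closure_of_isOpen_of_isOpen_compl {F : Type*} [TopologicalSpace F] [PreconnectedSpace F]
    {p : F} {A B : Set F} (hA : IsOpen A) (hB : IsOpen B) (hAB : A ∪ B = {p}ᶜ)
    (hd : Disjoint A B) (hne : A.Nonempty) : p ∈ closure A := by
  by_contra hp
  have hcl : IsClosed A := by
    refine isClosed_of_closure_subset fun x hx => ?_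
    have hxp : x ≠ p := by rintro rfl; exact hp hx
    rcases hAB.ge hxp with h | h
    · exact h
    · exact absurd hx (disjoint_right.1 (hd.closure_left hB) h)
  have := IsClopen.eq_univ ⟨hcl, hA⟩ hne
  exact hAB.le (.inl (this.ge (mem_univ p))) rfl

/-- In a connected space, if `{p}ᶜ` is the union of disjoint open sets `A` and `B`, then
`A ∪ {p}` is connected. -/
theorem isPreconnected_insert_of_isOpen {F : Type*} [TopologicalSpace F] [PreconnectedSpace F]
    {p : F} {A B : Set F} (hA : IsOpen A) (hB : IsOpen B) (hAB : A ∪ B = {p}ᶜ)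
    (hd : Disjoint A B) : IsPreconnected (insert p A) := by
  have hpA : p ∉ A := fun hp => hAB.le (.inl hp) rfl
  have hpB : p ∉ B := fun hp => hAB.le (.inr hp) rfl
  have hcov : ∀ x, x ≠ p → x ∈ A ∨ x ∈ B := fun x hx => hAB.ge hx
  -- a relatively clopen subset of `A ∪ {p}` away from `p` is clopen in the whole space
  have key : ∀ u v : Set F, IsOpen u → IsOpen v → insert p A ⊆ u ∪ v → p ∈ u →
      (insert p A ∩ v).Nonempty → (insert p A ∩ (u ∩ v)).Nonempty := by
    intro u v hu hv huv hpu ⟨y, hy, hyv⟩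
    by_contra hemp
    rw [not_nonempty_iff_eq_empty] at hemp
    have hdis : ∀ x, x ∈ insert p A → x ∈ u → x ∈ v → False := fun x hx hxu hxv =>
      (hemp.le ⟨hx, hxu, hxv⟩ : x ∈ (∅ : Set F))
    have hclop : IsClopen (A ∩ v) := by
      refine ⟨isOpen_compl_iff.1 ?_, hA.inter hv⟩
      have : (A ∩ v)ᶜ = u ∪ B := by
        ext x
        constructor
        · intro hx
          by_cases hxp : x = p
          · subst hxp; exact .inl hpu
          · rcases hcov x hxp with h | h
            · rcases huv (.inr h) with h' | h'
              · exact .inl h'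
              · exact absurd ⟨h, h'⟩ hx
            · exact .inr h
        · rintro (h1 | h1) ⟨h2, h3⟩
          · exact hdis x (.inr h2) h1 h3
          · exact disjoint_left.1 hd h2 h1
      rw [this]
      exact hu.union hB
    rcases isClopen_iff.1 hclop with h | h
    · rcases hy with rfl | hy
      · exact hdis y (.inl rfl) hpu hyv
      · exact h.le ⟨hy, hyv⟩
    · exact hpA (h.ge (mem_univ p)).1
  intro u v hu hv huv hu' hv'
  rcases huv (mem_insert p A) with hp | hp
  · exact key u v hu hv huv hp hv'
  · rw [inter_comm u v]
    exact key v u hv hu (by rwa [union_comm]) hp hu'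

/-- A relation as in `exists_separating_relation`, on a connected space, is a strict linear order:
if `q` is on the positive side of `p`, then the connected set formed by `p` and its positive side,
which avoids any point `l` of the negative side, can be crossed from `p` to `q`, so that `l` is on
the negative side of `q` too. -/
theorem isStrictTotalOrder_of_separating {F : Type*} [TopologicalSpace F] [PreconnectedSpace F]
    {R : F → F → Prop} (hR : IsOpen {x : F × F | x.1 ≠ x.2 ∧ R x.1 x.2})
    (hR' : IsOpen {x : F × F | x.1 ≠ x.2 ∧ ¬ R x.1 x.2}) (h1 : ∀ p, ∃ a, p ≠ a ∧ R p a)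
    (h2 : ∀ p, ∃ a, p ≠ a ∧ ¬ R p a) :
    (∀ p q, p ≠ q → (R p q ↔ ¬ R q p)) ∧
      ∀ p q r, p ≠ q → q ≠ r → R p q → R q r → p ≠ r ∧ R p r := by
  -- the situation is symmetric under the exchange of `R` with its negation
  have main : ∀ R : F → F → Prop, IsOpen {x : F × F | x.1 ≠ x.2 ∧ R x.1 x.2} →
      IsOpen {x : F × F | x.1 ≠ x.2 ∧ ¬ R x.1 x.2} → (∀ p, ∃ a, p ≠ a ∧ ¬ R p a) →
      (∀ p q l, p ≠ q → R p q → p ≠ l → ¬ R p l → q ≠ l ∧ ¬ R q l) ∧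
      ∀ p q, p ≠ q → R p q → ¬ R q p := by
    intro R hR hR' h2
    have hA : ∀ p, IsOpen {a | p ≠ a ∧ R p a} := fun p =>
      hR.preimage (f := fun a => (p, a)) (by fun_prop)
    have hB : ∀ p, IsOpen {a | p ≠ a ∧ ¬ R p a} := fun p =>
      hR'.preimage (f := fun a => (p, a)) (by fun_prop)
    have hAB : ∀ p, {a | p ≠ a ∧ R p a} ∪ {a | p ≠ a ∧ ¬ R p a} = {p}ᶜ := fun p => by
      ext a
      simp only [mem_union, mem_ofPred_eq, mem_compl_iff, mem_singleton_iff, ← and_or_left, eq_comm]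
      tauto
    have hd : ∀ p, Disjoint {a | p ≠ a ∧ R p a} {a | p ≠ a ∧ ¬ R p a} := fun p =>
      disjoint_left.2 fun a ha ha' => ha'.2 ha.2
    have hsub : ∀ p q l, p ≠ q → R p q → p ≠ l → ¬ R p l → q ≠ l ∧ ¬ R q l := by
      intro p q l hpq hRpq hpl hRpl
      have hpre := isPreconnected_insert_of_isOpen (hA p) (hB p) (hAB p) (hd p)
      have hl : ∀ x ∈ insert p {a | p ≠ a ∧ R p a}, x ≠ l := by
        rintro x (rfl | hx) rfl
        · exact hpl rfl
        · exact hRpl hx.2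
      have := hpre.subset_left_of_subset_union
        (hR'.preimage (f := fun x => (x, l)) (by fun_prop))
        (hR.preimage (f := fun x => (x, l)) (by fun_prop))
        (disjoint_left.2 fun x hx hx' => hx.2 hx'.2)
        (fun x hx => by
          by_cases hxl : R x l
          · exact .inr ⟨hl x hx, hxl⟩
          · exact .inl ⟨hl x hx, hxl⟩)
        ⟨p, mem_insert _ _, hpl, hRpl⟩
      exact this (.inr ⟨hpq, hRpq⟩)
    refine ⟨hsub, fun p q hpq hRpq hRqp => ?_⟩
    have hp : p ∈ closure {a | p ≠ a ∧ ¬ R p a} :=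
      mem_closure_of_isOpen_of_isOpen_compl (hB p) (hA p) (by rw [union_comm, hAB]) (hd p).symm
        (h2 p)
    have hp' : p ∈ closure {a | q ≠ a ∧ ¬ R q a} :=
      closure_mono (fun l hl => hsub p q l hpq hRpq hl.1 hl.2) hp
    exact disjoint_right.1 ((hd q).symm.closure_left (hA q)) ⟨hpq.symm, hRqp⟩ hp'
  obtain ⟨ma, mb⟩ := main R hR hR' h2
  obtain ⟨ma', mb'⟩ := main (fun p q => ¬ R p q) hR' (by simpa only [not_not] using hR)
    (by simpa only [not_not] using h1)
  have hiff : ∀ p q, p ≠ q → (R p q ↔ ¬ R q p) := fun p q hpq =>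
    ⟨mb p q hpq, fun h => by
      have := mb' q p hpq.symm h
      simpa only [not_not] using this⟩
  refine ⟨hiff, fun p q r hpq hqr hRpq hRqr => ?_⟩
  have h3 := ma q r p hqr hRqr hpq.symm ((hiff p q hpq).1 hRpq)
  exact ⟨h3.1.symm, (hiff p r h3.1.symm).2 h3.2⟩

/-- A connected, locally connected, separable space with a linear order without endpoints whose open
rays are open is homeomorphic to the line. -/
theorem nonempty_homeomorph_real {F : Type*} [TopologicalSpace F] [LinearOrder F] [Nonempty F]
    [PreconnectedSpace F] [LocallyConnectedSpace F] [SecondCountableTopology F]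
    [NoMinOrder F] [NoMaxOrder F] (hlt : ∀ a : F, IsOpen (Iio a)) (hgt : ∀ a : F, IsOpen (Ioi a)) :
    Nonempty (F ≃ₜ ℝ) := by
  have hIoo : ∀ a b : F, a < b → (Ioo a b).Nonempty := by
    intro a b hab
    by_contra hemp
    have hcompl : (Iio b)ᶜ = Ioi a := by
      ext x
      simp only [mem_compl_iff, mem_Iio, not_lt, mem_Ioi]
      refine ⟨hab.trans_le, fun hx => ?_⟩
      by_contra hxb
      exact hemp ⟨x, hx, not_le.1 hxb⟩
    have hcl : IsClopen (Iio b) := ⟨isOpen_compl_iff.1 (hcompl ▸ hgt a), hlt b⟩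
    exact lt_irrefl b ((hcl.eq_univ ⟨a, hab⟩).ge (mem_univ b))
  obtain ⟨Q, hQc, hQd⟩ := TopologicalSpace.exists_countable_dense F
  have hQ : ∀ a b : F, a < b → ∃ q ∈ Q, a < q ∧ q < b := fun a b hab => by
    obtain ⟨q, hq, hqQ⟩ := hQd.inter_open_nonempty _ ((hgt a).inter (hlt b)) (hIoo a b hab)
    exact ⟨q, hqQ, hq⟩
  have hQlt : ∀ a : F, ∃ q ∈ Q, q < a := fun a => by
    obtain ⟨b, hb⟩ := exists_lt a
    obtain ⟨q, hq, -, hqa⟩ := hQ b a hb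
    exact ⟨q, hq, hqa⟩
  have hQgt : ∀ a : F, ∃ q ∈ Q, a < q := fun a => by
    obtain ⟨b, hb⟩ := exists_gt a
    obtain ⟨q, hq, hqa, -⟩ := hQ a b hb
    exact ⟨q, hq, hqa⟩
  have i0 : Countable Q := hQc
  have i1 : Nonempty Q := hQd.nonempty.to_subtype
  have i2 : DenselyOrdered Q := ⟨fun a b hab => by
    obtain ⟨q, hq, h1, h2⟩ := hQ a b hab
    exact ⟨⟨q, hq⟩, h1, h2⟩⟩
  have i3 : NoMinOrder Q := ⟨fun a => by
    obtain ⟨q, hq, h1⟩ := hQlt a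
    exact ⟨⟨q, hq⟩, h1⟩⟩
  have i4 : NoMaxOrder Q := ⟨fun a => by
    obtain ⟨q, hq, h1⟩ := hQgt a
    exact ⟨⟨q, hq⟩, h1⟩⟩
  obtain ⟨e⟩ := Order.iso_of_countable_dense Q ℚ
  -- `f` extends the isomorphism `e` of a countable dense subset with the rational numbers
  let S : F → Set ℝ := fun p => {r | ∃ q : Q, (q : F) < p ∧ (e q : ℝ) = r}
  let f : F → ℝ := fun p => sSup (S p)
  have hSne : ∀ p, (S p).Nonempty := fun p => by
    obtain ⟨q, hq, h1⟩ := hQlt p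
    exact ⟨_, ⟨q, hq⟩, h1, rfl⟩
  have hSub : ∀ (p : F) (q : Q), p ≤ q → (e q : ℝ) ∈ upperBounds (S p) := by
    rintro p q hpq _ ⟨q', hq', rfl⟩
    exact_mod_cast e.monotone (show q' ≤ q from hq'.le.trans hpq)
  have hSbdd : ∀ p, BddAbove (S p) := fun p => by
    obtain ⟨q, hq, h1⟩ := hQgt p
    exact ⟨_, hSub p ⟨q, hq⟩ h1.le⟩
  have hlef : ∀ (p : F) (q : Q), (q : F) < p → (e q : ℝ) ≤ f p := fun p q h =>
    le_csSup (hSbdd p) ⟨q, h, rfl⟩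
  have hfle : ∀ (p : F) (q : Q), p ≤ q → f p ≤ e q := fun p q h =>
    csSup_le (hSne p) (hSub p q h)
  have hmono : StrictMono f := by
    intro a b hab
    obtain ⟨q, hq, h1, h2⟩ := hQ a b hab
    obtain ⟨q', hq', h3, h4⟩ := hQ q b h2
    refine (hfle a ⟨q, hq⟩ h1.le).trans_lt (lt_of_lt_of_le ?_ (hlef b ⟨q', hq'⟩ h4))
    exact_mod_cast e.strictMono (show (⟨q, hq⟩ : Q) < ⟨q', hq'⟩ from h3)
  have hfQ : ∀ q : Q, f q = e q := fun q => by
    refine le_antisymm (hfle q q le_rfl) (le_of_forall_rat_lt_imp_le fun t ht => ?_)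
    have h1 : t < e q := by exact_mod_cast ht
    have h2 := hlef q (e.symm t) (by
      have : e.symm t < q := by rwa [← e.lt_iff_lt, e.apply_symm_apply]
      exact this)
    rwa [e.apply_symm_apply] at h2
  have hcont : Continuous f := by
    refine continuous_iff_continuousAt.2 fun p => tendsto_order.2 ⟨fun r hr => ?_, fun r hr => ?_⟩
    · obtain ⟨_, ⟨q, hq, rfl⟩, hrq⟩ := exists_lt_of_lt_csSup (hSne p) hr
      filter_upwards [(hgt (q : F)).mem_nhds hq] with x hx
      exact hrq.trans_le (hlef x q hx)
    · obtain ⟨t, ht1, ht2⟩ := exists_rat_btwn hr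
      have hpq : p < e.symm t := by
        rw [← hmono.lt_iff_lt, hfQ, e.apply_symm_apply]
        exact ht1
      filter_upwards [(hlt (e.symm t : F)).mem_nhds hpq] with x hx
      have h1 := hfle x (e.symm t) (le_of_lt hx)
      rw [e.apply_symm_apply] at h1
      exact h1.trans_lt ht2
  have hsurj : Function.Surjective f := by
    intro y
    obtain ⟨t, ht1, ht2⟩ := exists_rat_btwn (sub_one_lt y)
    obtain ⟨t', ht1', ht2'⟩ := exists_rat_btwn (lt_add_one y)
    have hr : (range f).OrdConnected := (isPreconnected_range hcont).ordConnected
    have hmem : ∀ s : ℚ, (s : ℝ) ∈ range f := fun s => ⟨e.symm s, by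
      rw [hfQ, e.apply_symm_apply]⟩
    exact hr.out (hmem t) (hmem t') ⟨ht2.le, ht1'.le⟩
  have hopen : IsOpenMap f := by
    refine isOpenMap_iff_nhds_le.2 fun p => ?_
    intro N hN
    rw [mem_map] at hN
    obtain ⟨C, ⟨hCo, hpC, hCc⟩, hCN⟩ :=
      (LocallyConnectedSpace.open_connected_basis p).mem_iff.1 hN
    have hdisj : Disjoint (Iio p) (Ioi p) := disjoint_left.2 fun x hx hx' => lt_asymm hx hx'
    obtain ⟨l, hlC, hl⟩ := mem_closure_iff.1 (mem_closure_of_isOpen_of_isOpen_compl (hlt p) (hgt p)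
      Iio_union_Ioi hdisj (nonempty_Iio)) C hCo hpC
    obtain ⟨r, hrC, hr⟩ := mem_closure_iff.1 (mem_closure_of_isOpen_of_isOpen_compl (hgt p) (hlt p)
      (by rw [union_comm, Iio_union_Ioi]) hdisj.symm (nonempty_Ioi)) C hCo hpC
    have hconn : (f '' C).OrdConnected :=
      (hCc.isPreconnected.image f hcont.continuousOn).ordConnected
    have hsub := hconn.out (mem_image_of_mem f hlC) (mem_image_of_mem f hrC)
    refine mem_of_superset (Icc_mem_nhds (hmono hl) (hmono hr)) (hsub.trans ?_)
    rintro _ ⟨x, hx, rfl⟩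
    exact hCN hx
  exact ⟨(Equiv.ofBijective f ⟨hmono.injective, hsurj⟩).toHomeomorphOfContinuousOpen hcont hopen⟩

/-- The line is the only space whose product with the line is the plane: the lines of the product
have two sides, which order them. -/
theorem nonempty_homeomorph_real_of_prod {F : Type*} [TopologicalSpace F] (h : F × ℝ ≃ₜ ℂ) :
    Nonempty (F ≃ₜ ℝ) := by
  classical
  have hemb : IsEmbedding fun a : F => h (a, 0) := h.isEmbedding.comp (isEmbedding_prodMkLeft 0)
  have : T2Space F := hemb.t2Space
  have : SecondCountableTopology F := hemb.secondCountableTopology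
  have := contractibleSpace_of_prod_homeomorph h
  have : LocallyConnectedSpace (F × ℝ) := h.locallyConnectedSpace
  have : LocallyConnectedSpace F :=
    ((isOpenMap_fst (X := F) (Y := ℝ)).isQuotientMap continuous_fst Prod.fst_surjective
      ).isCoinducing.locallyConnectedSpace
  obtain ⟨R, hR, hR', h1, h2⟩ := exists_separating_relation h
  obtain ⟨hiff, htrans⟩ := isStrictTotalOrder_of_separating hR hR' h1 h2
  let i : LinearOrder F :=
    { le := fun a b => a = b ∨ R a b
      lt := fun a b => a ≠ b ∧ R a b
      le_refl := fun a => .inl rfl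
      le_trans := by
        rintro a b c (rfl | hab) (rfl | hbc)
        · exact .inl rfl
        · exact .inr hbc
        · exact .inr hab
        · by_cases e1 : a = b
          · subst e1; exact .inr hbc
          by_cases e2 : b = c
          · subst e2; exact .inr hab
          exact .inr (htrans a b c e1 e2 hab hbc).2
      lt_iff_le_not_ge := by
        intro a b
        by_cases hab : a = b
        · simp [hab]
        · simp [hab, Ne.symm hab, ← hiff a b hab]
      le_antisymm := by
        rintro a b (hab | hab) (hba | hba)
        · exact hab
        · exact hab
        · exact hba.symm
        · by_contra hne
          exact (hiff a b hne).1 hab hba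
      le_total := by
        intro a b
        by_cases hab : a = b
        · exact .inl (.inl hab)
        by_cases hR : R a b
        · exact .inl (.inr hR)
        · exact .inr (.inr ((hiff b a (Ne.symm hab)).2 hR))
      toDecidableLE := Classical.decRel _ }
  have hnomax : NoMaxOrder F := ⟨fun a => h1 a⟩
  have hnomin : NoMinOrder F := ⟨fun a => by
    obtain ⟨b, hab, hb⟩ := h2 a
    exact ⟨b, hab.symm, (hiff b a hab.symm).2 hb⟩⟩
  exact nonempty_homeomorph_real (fun a => hR.preimage (f := fun b => (b, a)) (by fun_prop))
    (fun a => hR.preimage (f := fun b => (a, b)) (by fun_prop))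

/-- A locally trivial fibration of the plane over the line is isomorphic to the first projection
of `ℝ × ℝ`. -/
theorem IsLocallyTrivialFibration.exists_homeomorph {P : Type*} [TopologicalSpace P]
    {π : P → ℝ} (h : IsLocallyTrivialFibration π) (e : P ≃ₜ ℝ × ℝ) :
    ∃ k : P ≃ₜ ℝ × ℝ, ∀ p, (k p).1 = π p := by
  obtain ⟨k, hk⟩ := exists_homeomorph_prod_of_forall_trivialization
    (h.exists_trivialization 0)
  obtain ⟨j⟩ := nonempty_homeomorph_real_of_prod
    ((Homeomorph.prodComm _ _).trans (k.symm.trans (e.trans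
      Complex.equivRealProdCLM.toHomeomorph.symm)))
  exact ⟨k.trans ((Homeomorph.refl ℝ).prodCongr j), hk⟩

/-! ### The collapse in vertical coordinates -/

/-- The signed length of the part of the vertical segment from `(x, 0)` to `(x, y)` which lies
outside `E`. -/
noncomputable def heightOutside (E : Set (ℝ × ℝ)) (q : ℝ × ℝ) : ℝ :=
  ∫ t in (0 : ℝ)..q.2, Eᶜ.indicator (fun _ => (1 : ℝ)) (q.1, t)

section HeightOutside

variable {E : Set (ℝ × ℝ)}

theorem intervalIntegrable_indicator_vertical (hE : IsClosed E) (x a b : ℝ) :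
    IntervalIntegrable (fun t => Eᶜ.indicator (fun _ => (1 : ℝ)) (x, t))
      MeasureTheory.volume a b := by
  refine (intervalIntegrable_const (c := (1 : ℝ))).mono_fun ?_ ?_
  · exact ((measurable_const.indicator hE.measurableSet.compl).comp
      (measurable_prodMk_left (x := x))).aestronglyMeasurable
  · exact Eventually.of_forall fun t => norm_indicator_le_norm_self _ _

theorem heightOutside_sub (hE : IsClosed E) (x y y' : ℝ) :
    heightOutside E (x, y') - heightOutside E (x, y) =
      ∫ t in y..y', Eᶜ.indicator (fun _ => (1 : ℝ)) (x, t) :=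
  intervalIntegral.integral_interval_sub_left (intervalIntegrable_indicator_vertical hE x _ _)
    (intervalIntegrable_indicator_vertical hE x _ _)

theorem indicator_vertical_nonneg (x t : ℝ) : 0 ≤ Eᶜ.indicator (fun _ => (1 : ℝ)) (x, t) :=
  indicator_nonneg (fun _ _ => zero_le_one) _

theorem heightOutside_mono (hE : IsClosed E) (x : ℝ) :
    Monotone fun y => heightOutside E (x, y) := by
  intro y y' h
  have h1 := heightOutside_sub hE x y y'
  have h2 : 0 ≤ ∫ t in y..y', Eᶜ.indicator (fun _ => (1 : ℝ)) (x, t) :=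
    intervalIntegral.integral_nonneg h fun t _ => indicator_vertical_nonneg x t
  simp only
  linarith

theorem heightOutside_lt (hE : IsClosed E) {x y y' t : ℝ} (h : y < y') (ht : t ∈ Icc y y')
    (htE : (x, t) ∉ E) : heightOutside E (x, y) < heightOutside E (x, y') := by
  have h1 := heightOutside_sub hE x y y'
  have hO : IsOpen {s | (x, s) ∉ E} := hE.isOpen_compl.preimage (by fun_prop)
  have hne : ({s | (x, s) ∉ E} ∩ Ioo y y').Nonempty := by
    rw [← closure_Ioo h.ne] at ht
    exact mem_closure_iff.1 ht _ hO htE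
  have h2 : 0 < ∫ t in y..y', Eᶜ.indicator (fun _ => (1 : ℝ)) (x, t) := by
    rw [intervalIntegral.integral_pos_iff_support_of_nonneg_ae
      (Eventually.of_forall fun t => indicator_vertical_nonneg x t)
      (intervalIntegrable_indicator_vertical hE x _ _)]
    refine ⟨h, ((hO.inter isOpen_Ioo).measure_pos _ hne).trans_le
      (MeasureTheory.measure_mono ?_)⟩
    rintro s ⟨hs1, hs2⟩
    refine ⟨?_, Ioo_subset_Ioc_self hs2⟩
    have : (x, s) ∈ Eᶜ := hs1
    simp [this]
  linarith

theorem heightOutside_eq_of_subset (hE : IsClosed E) {x y y' : ℝ} (h : y ≤ y')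
    (hsub : ∀ t ∈ Icc y y', (x, t) ∈ E) : heightOutside E (x, y) = heightOutside E (x, y') := by
  have h1 := heightOutside_sub hE x y y'
  have h2 : ∫ t in y..y', Eᶜ.indicator (fun _ => (1 : ℝ)) (x, t) = ∫ t in y..y', (0 : ℝ) := by
    refine intervalIntegral.integral_congr fun t ht => ?_
    rw [uIcc_of_le h] at ht
    simp [hsub t ht]
  rw [h2, intervalIntegral.integral_zero] at h1
  linarith

theorem heightOutside_sub_of_disjoint (hE : IsClosed E) {x y y' : ℝ} (h : y ≤ y')
    (hdis : ∀ t ∈ Icc y y', (x, t) ∉ E) :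
    heightOutside E (x, y') - heightOutside E (x, y) = y' - y := by
  rw [heightOutside_sub hE]
  have h2 : ∫ t in y..y', Eᶜ.indicator (fun _ => (1 : ℝ)) (x, t) = ∫ t in y..y', (1 : ℝ) := by
    refine intervalIntegral.integral_congr fun t ht => ?_
    rw [uIcc_of_le h] at ht
    have : (x, t) ∈ Eᶜ := hdis t ht
    simp [this]
  rw [h2]
  simp

/-- By dominated convergence: the indicator function of the complement of `E` is locally constant
off the frontier of `E`, which meets every vertical line in a null set. -/
theorem continuous_heightOutside (hE : IsClosed E)
    (hfr : ∀ x, {t | (x, t) ∈ frontier E}.Countable) : Continuous (heightOutside E) := by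
  refine continuous_prod_of_continuous_lipschitzWith' _ 1 (fun x => ?_) (fun y => ?_)
  · refine LipschitzWith.of_dist_le_mul fun y y' => ?_
    rw [NNReal.coe_one, one_mul, dist_comm, dist_comm y, Real.dist_eq, Real.dist_eq,
      heightOutside_sub hE]
    have := intervalIntegral.norm_integral_le_of_norm_le_const (a := y) (b := y') (C := 1)
      (f := fun t => Eᶜ.indicator (fun _ => (1 : ℝ)) (x, t)) (fun t _ =>
        (norm_indicator_le_norm_self _ _).trans (by simp))
    simpa using this
  · refine continuous_iff_continuousAt.2 fun x => ?_
    refine intervalIntegral.continuousAt_of_dominated_interval (bound := fun _ => 1)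
      (Eventually.of_forall fun x => ?_) (Eventually.of_forall fun x => ?_)
      intervalIntegrable_const ?_
    · exact ((measurable_const.indicator hE.measurableSet.compl).comp
        (measurable_prodMk_left (x := x))).aestronglyMeasurable
    · exact Eventually.of_forall fun t _ => (norm_indicator_le_norm_self _ _).trans (by simp)
    · have hnull : MeasureTheory.volume {t | (x, t) ∈ frontier E} = 0 := (hfr x).measure_zero _
      filter_upwards [MeasureTheory.compl_mem_ae_iff.2 hnull] with t ht _
      have hc : Tendsto (fun x => (x, t)) (𝓝 x) (𝓝 (x, t)) :=
        Continuous.tendsto (by fun_prop) x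
      by_cases hxt : (x, t) ∈ E
      · have hint : (x, t) ∈ interior E := by
          by_contra hn
          exact ht (hE.frontier_eq ▸ ⟨hxt, hn⟩)
        refine (continuousAt_const (y := (0 : ℝ))).congr ?_
        filter_upwards [hc (isOpen_interior.mem_nhds hint)] with z hz
        have : (z, t) ∈ E := interior_subset hz
        simp [this]
      · refine (continuousAt_const (y := (1 : ℝ))).congr ?_
        filter_upwards [hc (hE.isOpen_compl.mem_nhds hxt)] with z hz
        have : (z, t) ∈ Eᶜ := hz
        simp [this]

/-- The map which replaces the second coordinate by the height outside `E`. -/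
noncomputable def collapseCoord (E : Set (ℝ × ℝ)) (q : ℝ × ℝ) : ℝ × ℝ := (q.1, heightOutside E q)

/-- Over a strip where `E` is bounded, the second coordinate is bounded in terms of the height:
outside the bound of `E`, both grow at the same speed. -/
theorem abs_le_of_heightOutside (hE : IsClosed E) {M B : ℝ}
    (hB : ∀ q ∈ E, |q.1| ≤ M → |q.2| < B) {q : ℝ × ℝ} (hq : |q.1| ≤ M) :
    |q.2| ≤ |B| + |heightOutside E q| := by
  obtain ⟨x, y⟩ := q
  have hdis : ∀ t, |B| ≤ |t| → (x, t) ∉ E := fun t ht hE' =>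
    absurd (hB _ hE' hq) (not_lt.2 ((le_abs_self B).trans ht))
  have h00 : heightOutside E (x, 0) = 0 := by simp [heightOutside]
  have hB0 := abs_nonneg B
  simp only
  by_contra! hlt
  rcases le_total 0 y with hy | hy
  · rw [abs_of_nonneg hy] at hlt
    have hy' : |B| ≤ y := by linarith [abs_nonneg (heightOutside E (x, y))]
    have h1 := heightOutside_sub_of_disjoint hE (x := x) hy' fun t ht =>
      hdis t (ht.1.trans (le_abs_self t))
    have h2 := heightOutside_mono hE x hB0
    simp only [h00] at h2
    linarith [le_abs_self (heightOutside E (x, y))]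
  · rw [abs_of_nonpos hy] at hlt
    have hy' : y ≤ -|B| := by linarith [abs_nonneg (heightOutside E (x, y))]
    have h1 := heightOutside_sub_of_disjoint hE (x := x) hy' fun t ht =>
      hdis t ((le_neg.1 ht.2).trans (neg_le_abs t))
    have h2 := heightOutside_mono hE x (neg_nonpos.2 hB0)
    simp only [h00] at h2
    linarith [neg_le_abs (heightOutside E (x, y))]

theorem isProperMap_collapseCoord (hE : IsClosed E) (hcont : Continuous (heightOutside E))
    (hbdd : ∀ M : ℝ, ∃ B : ℝ, ∀ q ∈ E, |q.1| ≤ M → |q.2| < B) :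
    IsProperMap (collapseCoord E) := by
  have hc : Continuous (collapseCoord E) := continuous_fst.prodMk hcont
  refine isProperMap_iff_isCompact_preimage.2 ⟨hc, fun K hK => ?_⟩
  obtain ⟨R, hR⟩ := hK.isBounded.subset_closedBall 0
  obtain ⟨B, hB⟩ := hbdd R
  refine ((isCompact_Icc (a := -R) (b := R)).prod
    (isCompact_Icc (a := -(|B| + R)) (b := |B| + R))).of_isClosed_subset
    (hK.isClosed.preimage hc) fun q hq => ?_
  have h1 := mem_closedBall_zero_iff.1 (hR hq)
  have h2 : |q.1| ≤ R := (norm_fst_le (collapseCoord E q)).trans h1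
  have h3 : |heightOutside E q| ≤ R := (norm_snd_le (collapseCoord E q)).trans h1
  have h4 := abs_le_of_heightOutside hE hB h2
  exact ⟨abs_le.1 h2, abs_le.1 (h4.trans (by linarith))⟩

theorem surjective_collapseCoord (hE : IsClosed E) (hcont : Continuous (heightOutside E))
    (hbdd : ∀ M : ℝ, ∃ B : ℝ, ∀ q ∈ E, |q.1| ≤ M → |q.2| < B) :
    Function.Surjective (collapseCoord E) := by
  rintro ⟨x, z⟩
  obtain ⟨B, hB⟩ := hbdd |x|
  have h00 : heightOutside E (x, 0) = 0 := by simp [heightOutside]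
  set y := |B| + |z| with hy
  have hy0 : 0 ≤ y := by positivity
  have h1 := abs_le_of_heightOutside hE hB (q := (x, y)) le_rfl
  have h2 := abs_le_of_heightOutside hE hB (q := (x, -y)) le_rfl
  have h3 := heightOutside_mono hE x hy0
  have h4 := heightOutside_mono hE x (neg_nonpos.2 hy0)
  simp only [h00] at h3 h4
  simp only [abs_neg] at h2
  rw [abs_of_nonneg hy0, abs_of_nonneg h3] at h1
  rw [abs_of_nonneg hy0, abs_of_nonpos h4] at h2
  obtain ⟨t, ht⟩ := mem_range_of_exists_le_of_exists_ge (c := z)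
    (f := fun t => heightOutside E (x, t)) (by fun_prop)
    ⟨-y, by linarith [neg_abs_le z]⟩ ⟨y, by linarith [le_abs_self z]⟩
  exact ⟨(x, t), Prod.ext rfl ht⟩

/-- Two points of a vertical line have the same image if and only if the segment between them lies
in `E`: a segment which leaves the closed set `E` does so along an interval of positive length. -/
theorem collapseCoord_eq_iff (hE : IsClosed E) {x y y' : ℝ} (h : y < y') :
    collapseCoord E (x, y) = collapseCoord E (x, y') ↔ ∀ t ∈ Icc y y', (x, t) ∈ E := by
  refine ⟨fun heq t ht => ?_, fun hsub => Prod.ext rfl (heightOutside_eq_of_subset hE h.le hsub)⟩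
  by_contra htE
  exact (heightOutside_lt hE h ht htE).ne (congrArg Prod.snd heq)

end HeightOutside

/-! ### The frontier of a domain of finite type -/

/-- The frontier of a domain of finite type meets every fiber in a countable set: it consists of
boundary points, and the noncritical ones are isolated in the fiber. -/
theorem VerticalPlane.IsDomainOfFiniteType.countable_frontier_inter_fiber {P : Type*}
    [TopologicalSpace P] {V : VerticalPlane P} {D : Set P} (hD : V.IsDomainOfFiniteType D) (x : ℝ) :
    (frontier D ∩ V.proj ⁻¹' {x}).Countable := by
  obtain ⟨e⟩ := V.homeomorphic_plane
  have hsec : SecondCountableTopology P := e.isEmbedding.secondCountableTopology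
  set C := surfaceBoundary D
  set T := (C ∩ V.proj ⁻¹' {x}) \ topCriticalSet V.proj C
  have hfr : frontier D ∩ V.proj ⁻¹' {x} ⊆ topCriticalSet V.proj C ∪ T := by
    rintro p ⟨hp, hpx⟩
    rw [hD.isClosed.frontier_eq] at hp
    have hpC : p ∈ C := by
      by_contra hpC
      exact hp.2 (mem_interior_of_notMem_surfaceBoundary
        (e.trans Complex.equivRealProdCLM.toHomeomorph.symm) hD.surface hp.1 hpC)
    by_cases hcr : p ∈ topCriticalSet V.proj C
    · exact .inl hcr
    · exact .inr ⟨⟨hpC, hpx⟩, hcr⟩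
  have hT : DiscreteTopology T := by
    rw [discreteTopology_subtype_iff']
    rintro p ⟨⟨hpC, hpx⟩, hcr⟩
    obtain ⟨U, hU, hpU, hemb⟩ : ∃ U : Set P, IsOpen U ∧ p ∈ U ∧
        IsEmbedding ((U ∩ C).domRestrict V.proj) := by
      by_contra hno
      exact hcr ⟨hpC, hno⟩
    refine ⟨U, hU, ?_⟩
    ext q
    constructor
    · rintro ⟨hqU, ⟨hqC, hqx⟩, -⟩
      have : (⟨q, hqU, hqC⟩ : (U ∩ C : Set P)) = ⟨p, hpU, hpC⟩ :=
        hemb.injective ((hqx : V.proj q = x).trans (hpx : V.proj p = x).symm)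
      exact congrArg Subtype.val this
    · rintro rfl
      exact ⟨hpU, ⟨hpC, hpx⟩, hcr⟩
  have hTc : T.Countable := TopologicalSpace.separableSpace_iff_countable.1 inferInstance
  exact (hD.finite_critical.countable.union hTc).mono hfr

/-! ### The collapse is a plane -/

/-- In vertical coordinates `k`, vertical equivalence is equality of the images under the collapse
coordinates. -/
theorem verticallyEquivalent_iff {P : Type*} [TopologicalSpace P] {π : P → ℝ} {D : Set P}
    (k : P ≃ₜ ℝ × ℝ) (hk : ∀ p, (k p).1 = π p) (hD : IsClosed (k.symm ⁻¹' D)) (p q : P) :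
    VerticallyEquivalent π D p q ↔
      collapseCoord (k.symm ⁻¹' D) (k p) = collapseCoord (k.symm ⁻¹' D) (k q) := by
  set E := k.symm ⁻¹' D with hE
  have key : ∀ p q, (k p).2 < (k q).2 → (VerticallyEquivalent π D p q ↔
      collapseCoord E (k p) = collapseCoord E (k q)) := by
    intro p q hlt
    have hkp : k p = (π p, (k p).2) := Prod.ext (hk p) rfl
    constructor
    · rintro ⟨hpq, ⟨hpD, hq⟩ | ⟨rfl, -⟩⟩
      · have hkq : k q = (π p, (k q).2) := Prod.ext ((hk q).trans hpq.symm) rfl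
        rw [hkp, hkq, collapseCoord_eq_iff hD hlt]
        have hpre : IsPreconnected
            ((fun r => (k r).2) '' connectedComponentIn (π ⁻¹' {π p} ∩ D) p) :=
          isPreconnected_connectedComponentIn.image _ (by fun_prop)
        intro t ht
        obtain ⟨r, hr, rfl⟩ := hpre.ordConnected.out
          (mem_image_of_mem _ (mem_connectedComponentIn ⟨rfl, hpD⟩)) (mem_image_of_mem _ hq) ht
        obtain ⟨hr1, hr2⟩ := connectedComponentIn_subset _ _ hr
        have : (π p, (k r).2) = k r := Prod.ext (hr1.symm.trans (hk r).symm) rfl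
        rw [hE, this]
        simpa using hr2
      · rfl
    · intro heq
      have hpq : π p = π q := by
        rw [← hk p, ← hk q]
        exact (congrArg Prod.fst heq : (collapseCoord E (k p)).1 = _)
      have hkq : k q = (π p, (k q).2) := Prod.ext ((hk q).trans hpq.symm) rfl
      rw [hkp, hkq, collapseCoord_eq_iff hD hlt] at heq
      refine ⟨hpq, .inl ⟨?_, ?_⟩⟩
      · have : k.symm (π p, (k p).2) ∈ D := heq _ ⟨le_rfl, hlt.le⟩
        rwa [← hkp, k.symm_apply_apply] at this
      · have hpre : IsPreconnected ((fun t => k.symm (π p, t)) '' Icc (k p).2 (k q).2) :=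
          isPreconnected_Icc.image _ (by fun_prop)
        refine hpre.subset_connectedComponentIn ⟨_, ⟨le_rfl, hlt.le⟩, ?_⟩ ?_
          ⟨_, ⟨hlt.le, le_rfl⟩, ?_⟩
        · simp only [← hkp, k.symm_apply_apply]
        · rintro _ ⟨t, ht, rfl⟩
          refine ⟨?_, heq t ht⟩
          rw [mem_preimage, mem_singleton_iff, ← hk]
          simp
        · simp only [← hkq, k.symm_apply_apply]
  rcases lt_trichotomy (k p).2 (k q).2 with h | h | h
  · exact key p q h
  · constructor
    · rintro ⟨hpq, -⟩
      rw [show k p = k q from Prod.ext (by rw [hk, hk, hpq]) h]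
    · intro heq
      have : p = q := k.injective
        (Prod.ext (congrArg Prod.fst heq : (collapseCoord E (k p)).1 = _) h)
      subst this
      exact (verticallyEquivalent_equivalence π D).refl p
  · rw [eq_comm, ← key q p h]
    exact ⟨(verticallyEquivalent_equivalence π D).symm, (verticallyEquivalent_equivalence π D).symm⟩

theorem exists_homeomorph_quotient_of_isQuotientMap {X Y : Type*} [TopologicalSpace X]
    [TopologicalSpace Y] {s : Setoid X} {f : X → Y} (hs : ∀ a b, s a b ↔ f a = f b)
    (hf : IsQuotientMap f) : ∃ K : Quotient s ≃ₜ Y, ∀ a, K (Quotient.mk s a) = f a := by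
  obtain rfl : s = Setoid.ker f := Setoid.ext hs
  have hf' : IsQuotientMap (ContinuousMap.mk f hf.continuous) := hf
  exact ⟨hf'.homeomorph, fun a => rfl⟩

/-- Vertical coordinates on a vertical plane and on its collapse along a domain `D` of finite type,
in which `D` becomes a closed set `E` and the collapsing map becomes `collapseCoord E`. -/
theorem VerticalPlane.IsDomainOfFiniteType.exists_coordinates {P : Type*} [TopologicalSpace P]
    {V : VerticalPlane P} {D : Set P} (hD : V.IsDomainOfFiniteType D) :
    ∃ (k : P ≃ₜ ℝ × ℝ) (E : Set (ℝ × ℝ)) (K : V.Collapse D ≃ₜ ℝ × ℝ),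
      (∀ p, (k p).1 = V.proj p) ∧ (∀ p, k p ∈ E ↔ p ∈ D) ∧ IsClosed E ∧
      Continuous (heightOutside E) ∧ (∃ p, p ∉ D) ∧
      ∀ p, K (V.collapseMap D p) = collapseCoord E (k p) := by
  obtain ⟨e⟩ := V.homeomorphic_plane
  obtain ⟨k, hk⟩ := V.locallyTrivial.exists_homeomorph e
  set E := k.symm ⁻¹' D with hE
  have hEc : IsClosed E := hD.isClosed.preimage k.symm.continuous
  have hfr : ∀ x, {t | (x, t) ∈ frontier E}.Countable := fun x => by
    refine (hD.countable_frontier_inter_fiber x).preimage_of_injOn (f := fun t => k.symm (x, t))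
      (fun t _ t' _ h => congrArg Prod.snd (k.symm.injective h)) |>.mono fun t ht => ?_
    have h1 : (x, t) ∈ k.symm ⁻¹' frontier D := by
      rw [k.symm.preimage_frontier]
      exact ht
    refine ⟨h1, ?_⟩
    rw [mem_preimage, mem_singleton_iff, ← hk]
    simp
  have hcont := continuous_heightOutside hEc hfr
  have hbdd : ∀ M : ℝ, ∃ B : ℝ, ∀ q ∈ E, |q.1| ≤ M → |q.2| < B := fun M => by
    have hc : IsCompact (D.domRestrict V.proj ⁻¹' Icc (-M) M) :=
      hD.proper.isCompact_preimage isCompact_Icc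
    have hc' := hc.image (f := fun p : D => k p) (by fun_prop)
    obtain ⟨B, hB⟩ := hc'.isBounded.subset_ball 0
    refine ⟨B, fun q hq hqM => ?_⟩
    have : q ∈ Metric.ball (0 : ℝ × ℝ) B := hB ⟨⟨k.symm q, hq⟩, by
      rw [mem_preimage, domRestrict_apply, ← hk]
      simpa using abs_le.1 hqM, by simp⟩
    exact (norm_snd_le q).trans_lt (mem_ball_zero_iff.1 this)
  have hq : IsQuotientMap fun p => collapseCoord E (k p) :=
    ((isProperMap_collapseCoord hEc hcont hbdd).isClosedMap.isQuotientMap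
      (continuous_fst.prodMk hcont) (surjective_collapseCoord hEc hcont hbdd)).comp
      k.isQuotientMap
  obtain ⟨K, hK⟩ := exists_homeomorph_quotient_of_isQuotientMap (s := verticalSetoid V.proj D)
    (fun a b => verticallyEquivalent_iff k hk hEc a b) hq
  refine ⟨k, E, K, hk, fun p => by simp [hE], hEc, hcont, ?_, hK⟩
  -- a point of the plane above the bounded slice of `E` over `0`
  obtain ⟨B, hB⟩ := hbdd 0
  exact ⟨k.symm (0, B), fun h => absurd (hB (0, B) h (by simp)) (not_lt.2 (le_abs_self B))⟩

/-- The complement of `D` is open, saturated, and its points are alone in their classes. -/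
theorem VerticalPlane.isOpenEmbedding_collapseMap {P : Type*} [TopologicalSpace P]
    (V : VerticalPlane P) {D : Set P} (hD : IsClosed D) :
    IsOpenEmbedding (Dᶜ.domRestrict (V.collapseMap D)) := by
  have hρ : ∀ p q, V.collapseMap D p = V.collapseMap D q → p ∉ D → p = q := fun p q h hp => by
    rcases Quotient.exact h with ⟨-, ⟨h1, -⟩ | ⟨h1, -⟩⟩
    · exact absurd h1 hp
    · exact h1
  refine .of_continuous_injective_isOpenMap ?_ (fun p q h => Subtype.ext (hρ p q h p.2)) ?_
  · exact continuous_quotient_mk'.comp continuous_subtype_val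
  · intro U hU
    have hU' : IsOpen (Subtype.val '' U) := hD.isOpen_compl.isOpenMap_subtype_val U hU
    have : V.collapseMap D ⁻¹' (Dᶜ.domRestrict (V.collapseMap D) '' U) = Subtype.val '' U := by
      ext p
      constructor
      · rintro ⟨q, hq, hqp⟩
        exact ⟨q, hq, hρ q p hqp q.2⟩
      · rintro ⟨q, hq, rfl⟩
        exact ⟨q, hq, rfl⟩
    exact isQuotientMap_quot_mk.isOpen_preimage.1 (this ▸ hU')

theorem isLocallyTrivialFibration_of_homeomorph {X : Type*} [TopologicalSpace X] (K : X ≃ₜ ℝ × ℝ) :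
    IsLocallyTrivialFibration fun c => (K c).1 := by
  intro x
  let e : Bundle.Trivialization ℝ (fun c => (K c).1) :=
    { K.toOpenPartialHomeomorph with
      baseSet := univ
      open_baseSet := isOpen_univ
      source_eq := by simp
      target_eq := by simp
      proj_toFun := fun p _ => rfl }
  exact ⟨e.transFiberHomeomorph (e.preimageSingletonHomeomorph (mem_univ x)).symm, mem_univ x⟩

/-! ### Orientations and local degrees -/

/-- The local degree of a map of `ℝ × ℝ`, identified with the complex plane. -/
def PlaneDegreeAt (f : ℝ × ℝ → ℝ × ℝ) (p : ℝ × ℝ) (n : ℤ) : Prop :=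
  DegreeAt (fun z => Complex.equivRealProdCLM.symm (f (Complex.equivRealProdCLM z)))
    (Complex.equivRealProdCLM.symm p) n

theorem PlaneDegreeAt.comp {f f' : ℝ × ℝ → ℝ × ℝ} {p : ℝ × ℝ} {n m : ℤ}
    (h' : PlaneDegreeAt f' (f p) m) (h : PlaneDegreeAt f p n) :
    PlaneDegreeAt (fun q => f' (f q)) p (m * n) := by
  have h1 := DegreeAt.comp (f := fun z => Complex.equivRealProdCLM.symm
    (f (Complex.equivRealProdCLM z))) (m := m) (by simpa [PlaneDegreeAt] using h') h
  simpa [PlaneDegreeAt, Function.comp_def] using h1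

theorem PlaneDegreeAt.unique {f : ℝ × ℝ → ℝ × ℝ} {p : ℝ × ℝ} {n m : ℤ}
    (h : PlaneDegreeAt f p n) (h' : PlaneDegreeAt f p m) : n = m :=
  DegreeAt.unique h h'

/-- The degree decides whether the orientation is preserved: both notions are read off the
angular part of the logarithm of `f - f p` along small circles
around `p`. -/
theorem PlaneDegreeAt.preservesOrientationAt_iff {f : ℝ × ℝ → ℝ × ℝ} {p : ℝ × ℝ} {n : ℤ}
    (h : PlaneDegreeAt f p n) : PreservesOrientationAt f p ↔ n = 1 := by
  obtain ⟨g, hg, hfg, hgn⟩ := h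
  let c : ℝ → ℝ → ℂ := fun r t => g (Real.log r + t * Complex.I)
  have hcc : ∀ r, Continuous (c r) := fun r => by fun_prop
  have hcper : ∀ r t, c r (t + 2 * Real.pi) = c r t + n * (2 * Real.pi * Complex.I) := by
    intro r t
    simp only [c]
    rw [← hgn]
    congr 1
    push_cast; ring
  have hc : ∀ r, 0 < r → ∀ t : ℝ, f (p + r • (Real.cos t, Real.sin t)) =
      f p + Real.exp (c r t).re • (Real.cos (c r t).im, Real.sin (c r t).im) := by
    intro r hr t
    have h1 := hfg (Real.log r + t * Complex.I)
    have h2 : Complex.equivRealProdCLM (Complex.equivRealProdCLM.symm p +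
        Complex.exp (Real.log r + t * Complex.I)) = p + r • (Real.cos t, Real.sin t) := by
      rw [map_add, ContinuousLinearEquiv.apply_symm_apply]
      congr 1
      ext <;> simp [Complex.exp_re, Complex.exp_im, Real.exp_log hr]
    simp only [h2, ContinuousLinearEquiv.apply_symm_apply] at h1
    rw [ContinuousLinearEquiv.symm_apply_eq, map_add, ContinuousLinearEquiv.apply_symm_apply] at h1
    rw [h1]
    congr 1
    ext <;> simp [c, Complex.exp_re, Complex.exp_im]
  constructor
  · intro hp
    obtain ⟨r, ⟨θ, hθ, hθper, hs⟩, hr⟩ := (hp.and self_mem_nhdsWithin).exists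
    choose s hs0 hs using hs
    have hexp : ∀ t, Complex.exp (c r t) = s t * Complex.exp (θ t * Complex.I) := by
      intro t
      have h1 := add_left_cancel ((hc r hr t).symm.trans (hs t))
      have h2 := congrArg Prod.fst h1
      have h3 := congrArg Prod.snd h1
      apply Complex.ext
      · simpa [Complex.exp_re, Complex.exp_im] using h2
      · simpa [Complex.exp_re, Complex.exp_im] using h3
    have hsexp : ∀ t, s t = Real.exp (c r t).re := fun t => by
      have := congrArg norm (hexp t)
      rw [norm_mul, Complex.norm_exp_ofReal_mul_I, Complex.norm_exp, mul_one, Complex.norm_real,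
        Real.norm_of_nonneg (hs0 t).le] at this
      exact this.symm
    refine log_increment_unique (g := fun z => c r z.im)
      (g' := fun z => (c r z.im).re + θ z.im * Complex.I) (by fun_prop) (by fun_prop)
      (fun z => ?_) (fun z => ?_) (fun z => ?_)
    · rw [hexp, Complex.exp_add, hsexp, Complex.ofReal_exp]
    · have : (z + 2 * Real.pi * Complex.I).im = z.im + 2 * Real.pi := by simp
      rw [this, hcper]
    · have : (z + 2 * Real.pi * Complex.I).im = z.im + 2 * Real.pi := by simp
      rw [this, hcper, hθper]
      have h4 : (c r z.im + n * (2 * Real.pi * Complex.I)).re = (c r z.im).re := by simp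
      rw [h4]
      push_cast; ring
  · rintro rfl
    refine mem_of_superset self_mem_nhdsWithin fun r hr => ?_
    refine ⟨fun t => (c r t).im, by fun_prop, fun t => ?_, fun t => ⟨_, Real.exp_pos _, hc r hr t⟩⟩
    simp [hcper]

theorem Homeomorph.exists_planeDegree (h : ℝ × ℝ ≃ₜ ℝ × ℝ) :
    ∃ n : ℤ, (n = 1 ∨ n = -1) ∧ ∀ p, PlaneDegreeAt h p n := by
  obtain ⟨n, hn, hd⟩ := ((Complex.equivRealProdCLM.toHomeomorph.trans h).trans
    Complex.equivRealProdCLM.toHomeomorph.symm).exists_degreeAt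
  exact ⟨n, hn, fun p => hd _⟩

/-- The degree, `1` or `-1`, of a homeomorphism of the plane. -/
noncomputable def Homeomorph.planeDegree (h : ℝ × ℝ ≃ₜ ℝ × ℝ) : ℤ := h.exists_planeDegree.choose

theorem Homeomorph.planeDegree_eq (h : ℝ × ℝ ≃ₜ ℝ × ℝ) : h.planeDegree = 1 ∨ h.planeDegree = -1 :=
  h.exists_planeDegree.choose_spec.1

theorem Homeomorph.planeDegreeAt (h : ℝ × ℝ ≃ₜ ℝ × ℝ) (p : ℝ × ℝ) :
    PlaneDegreeAt h p h.planeDegree :=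
  h.exists_planeDegree.choose_spec.2 p

theorem Homeomorph.planeDegree_trans (h h' : ℝ × ℝ ≃ₜ ℝ × ℝ) :
    (h.trans h').planeDegree = h'.planeDegree * h.planeDegree :=
  ((h.trans h').planeDegreeAt 0).unique ((h'.planeDegreeAt _).comp (h.planeDegreeAt 0))

theorem Homeomorph.planeDegree_refl : (Homeomorph.refl (ℝ × ℝ)).planeDegree = 1 := by
  have h := (Homeomorph.refl (ℝ × ℝ)).planeDegree_trans (Homeomorph.refl (ℝ × ℝ))
  rw [show (Homeomorph.refl (ℝ × ℝ)).trans (Homeomorph.refl (ℝ × ℝ)) =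
    Homeomorph.refl (ℝ × ℝ) from rfl] at h
  rcases (Homeomorph.refl (ℝ × ℝ)).planeDegree_eq with h' | h'
  · exact h'
  · rw [h'] at h
    simp at h

theorem Homeomorph.planeDegree_symm (h : ℝ × ℝ ≃ₜ ℝ × ℝ) :
    h.symm.planeDegree = h.planeDegree := by
  have h1 := h.planeDegree_trans h.symm
  rw [Homeomorph.self_trans_symm, Homeomorph.planeDegree_refl] at h1
  rcases Int.mul_eq_one_iff_eq_one_or_neg_one.1 h1.symm with ⟨h2, h3⟩ | ⟨h2, h3⟩ <;> rw [h2, h3]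

theorem exists_planeDegree_eq_neg_one : ∃ h : ℝ × ℝ ≃ₜ ℝ × ℝ, h.planeDegree = -1 := by
  refine ⟨(Homeomorph.refl ℝ).prodCongr (Homeomorph.neg ℝ), ?_⟩
  refine (Homeomorph.planeDegreeAt _ 0).unique ?_
  have h1 := degreeAt_conj 0
  have h2 : (fun z => Complex.equivRealProdCLM.symm (((Homeomorph.refl ℝ).prodCongr
      (Homeomorph.neg ℝ)) (Complex.equivRealProdCLM z))) = (starRingEnd ℂ : ℂ → ℂ) := by
    ext z
    apply Complex.ext <;> simp
  rw [PlaneDegreeAt, h2]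
  simpa using h1

theorem PlaneOrientation.mem_charts_iff {X : Type*} [TopologicalSpace X] (o : PlaneOrientation X)
    {e : X ≃ₜ ℝ × ℝ} (he : e ∈ o.charts) (e' : X ≃ₜ ℝ × ℝ) :
    e' ∈ o.charts ↔ (e.symm.trans e').planeDegree = 1 := by
  rw [o.mem_iff e he e']
  constructor
  · intro h
    exact ((e.symm.trans e').planeDegreeAt 0).preservesOrientationAt_iff.1 (h 0)
  · intro h p
    exact ((e.symm.trans e').planeDegreeAt p).preservesOrientationAt_iff.2 h

theorem PlaneOrientation.eq_of_subset {X : Type*} [TopologicalSpace X] {o o' : PlaneOrientation X}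
    (h : o.charts ⊆ o'.charts) : o = o' := by
  obtain ⟨e, he⟩ := o.nonempty
  ext e'
  rw [o.mem_charts_iff he, o'.mem_charts_iff (h he)]

/-- The orientation for which the charts in the class of `K`, if `s = 1`, or in the opposite class,
if `s = -1`, are positive. -/
theorem exists_planeOrientation {X : Type*} [TopologicalSpace X] (K : X ≃ₜ ℝ × ℝ) {s : ℤ}
    (hs : s = 1 ∨ s = -1) :
    ∃ o : PlaneOrientation X, ∀ e, e ∈ o.charts ↔ (K.symm.trans e).planeDegree = s := by
  refine ⟨⟨{e | (K.symm.trans e).planeDegree = s}, ?_, fun e he e' => ?_⟩, fun e => Iff.rfl⟩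
  · rcases hs with rfl | rfl
    · exact ⟨K, by simp [Homeomorph.planeDegree_refl]⟩
    · obtain ⟨j, hj⟩ := exists_planeDegree_eq_neg_one
      refine ⟨K.trans j, ?_⟩
      have h1 : K.symm.trans (K.trans j) = j := by ext x <;> simp
      rwa [mem_ofPred_eq, h1]
  · have h1 : e.symm.trans e' = (K.symm.trans e).symm.trans (K.symm.trans e') := by
      ext x <;> simp
    have h2 : (∀ p, PreservesOrientationAt (fun q => e' (e.symm q)) p) ↔
        (e.symm.trans e').planeDegree = 1 :=
      ⟨fun h => ((e.symm.trans e').planeDegreeAt 0).preservesOrientationAt_iff.1 (h 0),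
        fun h p => ((e.symm.trans e').planeDegreeAt p).preservesOrientationAt_iff.2 h⟩
    rw [mem_ofPred_eq] at he
    rw [h2, h1, Homeomorph.planeDegree_trans, Homeomorph.planeDegree_symm, he, mem_ofPred_eq]
    rcases hs with rfl | rfl <;> rcases (K.symm.trans e').planeDegree_eq with h | h <;> simp [h]

/-- Outside `E`, the collapse in vertical coordinates has degree `1`: the straight-line homotopy to
the identity is increasing on the vertical line. -/
theorem planeDegreeAt_collapseCoord {E : Set (ℝ × ℝ)} (hE : IsClosed E)
    (hcont : Continuous (heightOutside E)) {p : ℝ × ℝ} (hp : p ∉ E) :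
    PlaneDegreeAt (collapseCoord E) p 1 := by
  have hc : Continuous (collapseCoord E) := continuous_fst.prodMk hcont
  let H : unitInterval × ℂ → ℂ := fun x => Complex.equivRealProdCLM.symm
    ((1 - (x.1 : ℝ)) • Complex.equivRealProdCLM x.2 +
      (x.1 : ℝ) • collapseCoord E (Complex.equivRealProdCLM x.2))
  have hlt : ∀ y y', y < y' → (p.1, y) = p ∨ (p.1, y') = p →
      heightOutside E (p.1, y) < heightOutside E (p.1, y') := by
    rintro y y' h (h' | h')
    · exact heightOutside_lt hE h ⟨le_rfl, h.le⟩ (h' ▸ hp)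
    · exact heightOutside_lt hE h ⟨h.le, le_rfl⟩ (h' ▸ hp)
  have hpos : ∀ (s : unitInterval) {a b : ℝ}, 0 < a → 0 < b → 0 < (1 - (s : ℝ)) * a + s * b := by
    intro s a b ha hb
    rcases s.2.1.eq_or_lt with h | h
    · simp [← h, ha]
    · have := mul_nonneg (sub_nonneg.2 s.2.2) ha.le
      have := mul_pos h hb
      linarith
  have key := DegreeAt.of_homotopy (H := H) (by fun_prop)
    (p := Complex.equivRealProdCLM.symm p) (n := 1) (fun s z hz heq => by
      have h1 := Complex.equivRealProdCLM.symm.injective heq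
      rw [ContinuousLinearEquiv.apply_symm_apply] at h1
      obtain ⟨q, rfl⟩ := Complex.equivRealProdCLM.symm.surjective z
      rw [ContinuousLinearEquiv.apply_symm_apply] at h1
      replace hz : q ≠ p := fun h => hz (h ▸ rfl)
      have h2 := congrArg Prod.fst h1
      have h3 := congrArg Prod.snd h1
      simp only [collapseCoord, Prod.fst_add, Prod.snd_add, Prod.smul_fst, Prod.smul_snd,
        smul_eq_mul] at h2 h3
      have h4 : q.1 = p.1 := by linarith
      have h5 : q = (p.1, q.2) := Prod.ext h4 rfl
      have h6 : (p.1, p.2) = p := rfl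
      rcases lt_trichotomy q.2 p.2 with h | h | h
      · have h7 := hlt _ _ h (.inr h6)
        rw [← h5, h6] at h7
        have := hpos s (sub_pos.2 h) (sub_pos.2 h7)
        linarith
      · exact hz (Prod.ext h4 h)
      · have h7 := hlt _ _ h (.inl h6)
        rw [← h5, h6] at h7
        have := hpos s (sub_pos.2 h) (sub_pos.2 h7)
        linarith)
    (by
      have h0 : (fun z => H (0, z)) = id := by
        ext z
        simp only [H, Set.Icc.coe_zero, sub_zero, one_smul, zero_smul, add_zero,
          ContinuousLinearEquiv.symm_apply_apply, id]
      rw [h0]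
      exact degreeAt_id _)
  have h1 : (fun z => H (1, z)) = fun z => Complex.equivRealProdCLM.symm
      (collapseCoord E (Complex.equivRealProdCLM z)) := by
    ext z
    simp only [H, Set.Icc.coe_one, sub_self, one_smul, zero_smul, zero_add]
  rwa [h1] at key

theorem mainTheorem7 {P : Type*} [TopologicalSpace P] (V : VerticalPlane P) (D : Set P)
    (hD : V.IsDomainOfFiniteType D) :
    Nonempty (V.Collapse D ≃ₜ ℝ × ℝ) ∧
    (∃! π' : V.Collapse D → ℝ, π' ∘ V.collapseMap D = V.proj) ∧
    IsOpenEmbedding (Dᶜ.domRestrict (V.collapseMap D)) ∧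
    (∃! o : PlaneOrientation (V.Collapse D),
      ∀ p ∈ Dᶜ, V.orientation.PreservedAt o (V.collapseMap D) p) ∧
    (∀ o : PlaneOrientation (V.Collapse D),
      (∀ p ∈ Dᶜ, V.orientation.PreservedAt o (V.collapseMap D) p) →
        ∃ W : VerticalPlane (V.Collapse D),
          W.orientation = o ∧ W.proj ∘ V.collapseMap D = V.proj) := by
  obtain ⟨k, E, K, hk, hkE, hE, hcont, ⟨p₀, hp₀⟩, hK⟩ := hD.exists_coordinates
  have hproj : (fun c => (K c).1) ∘ V.collapseMap D = V.proj := by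
    ext p
    simp only [Function.comp_apply, hK]
    exact hk p
  have hsurj : Function.Surjective (V.collapseMap D) := Quotient.mk_surjective
  obtain ⟨e₀, he₀⟩ := V.orientation.nonempty
  set s := (e₀.symm.trans k).planeDegree with hs
  -- all positive charts of the plane differ from the vertical coordinates by the same sign
  have hes : ∀ e ∈ V.orientation.charts, (e.symm.trans k).planeDegree = s := fun e he => by
    have h1 : e.symm.trans k = (e.symm.trans e₀).trans (e₀.symm.trans k) := by ext x <;> simp
    rw [h1, Homeomorph.planeDegree_trans, (V.orientation.mem_charts_iff he e₀).1 he₀, mul_one]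
  -- by multiplicativity of degrees, whether the collapsing map preserves the orientations does not
  -- depend on the point of the complement of `D`
  have hpres : ∀ p ∉ D, ∀ e ∈ V.orientation.charts, ∀ e' : V.Collapse D ≃ₜ ℝ × ℝ,
      (PreservesOrientationAt (fun q => e' (V.collapseMap D (e.symm q))) (e p) ↔
        (K.symm.trans e').planeDegree = s) := by
    intro p hp e he e'
    have h1 : (fun q => e' (V.collapseMap D (e.symm q))) =
        fun q => (K.symm.trans e') (collapseCoord E ((e.symm.trans k) q)) := by
      ext q <;> simp [← hK]
    have h2 : (e.symm.trans k) (e p) ∉ E := by simpa [hkE] using hp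
    have h3 := ((K.symm.trans e').planeDegreeAt _).comp
      ((planeDegreeAt_collapseCoord hE hcont h2).comp ((e.symm.trans k).planeDegreeAt (e p)))
    rw [h1, h3.preservesOrientationAt_iff, hes e he]
    rcases (e₀.symm.trans k).planeDegree_eq with h | h <;>
      rcases (K.symm.trans e').planeDegree_eq with h' | h' <;> simp [hs, h, h']
  obtain ⟨o, ho⟩ := exists_planeOrientation K (e₀.symm.trans k).planeDegree_eq
  refine ⟨⟨K⟩, ⟨_, hproj, fun π' hπ' => ?_⟩, V.isOpenEmbedding_collapseMap hD.isClosed,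
    ⟨o, fun p hp e he e' he' => (hpres p hp e he e').2 ((ho e').1 he'), fun o' ho' => ?_⟩,
    fun o' _ => ⟨⟨⟨K⟩, o', _, isLocallyTrivialFibration_of_homeomorph K⟩, rfl, hproj⟩⟩
  · exact hsurj.injective_comp_right (hπ'.trans hproj.symm)
  · exact PlaneOrientation.eq_of_subset fun e' he' =>
      (ho e').2 ((hpres p₀ hp₀ e₀ he₀ e').1 (ho' p₀ hp₀ e₀ he₀ e' he'))
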